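/- Let $w=\{w_k\}_{k\ge 1}$ be a sequence of positive real numbers with $\lim_{k\to\infty}w_k=1$, and put $\beta_0=1$, $\beta_k=\prod_{j=1}^k w_j$ for $k\ge 1$. Let $H^2_\beta$ be the weighted Hardy space of all analytic functions $f(z)=\sum_{k\ge 0}\widehat f(k)z^k$ on the open unit disk $\mathbb D$ with $\|f\|^2_{H^2_\beta}=\sum_{k\ge 0}\beta_k^2|\widehat f(k)|^2<\infty$. Assume that $H^2_\beta$ is of polynomial growth, that is, $$\sup_{k\ge 1}\,(k+1)\,|w_k-1|<\infty .$$ Let $m\ge 1$ and let $$B(z)=e^{i\theta}\prod_{j=1}^m\frac{z_j-z}{1-\overline{z_j}z},\qquad \theta\in\mathbb R,\ z_1,\dots,z_m\in\mathbb D,$$ be a finite Blaschke product of order $m$ (the zeros $z_j$ need not be distinct). Then the multiplication operators $M_z\colon f\mapsto zf$ and $M_B\colon f\mapsto Bf$ are bounded on $H^2_\beta$, and $M_B$ is similar to the orthogonal direct sum $\bigoplus_1^m M_z$ on $\bigoplus_1^m H^2_\beta$: there is a bounded linear bijection $X\colon H^2_\beta\to\bigoplus_1^m H^2_\beta$ with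 bounded inverse such that $XM_B=\bigl(\bigoplus_1^m M_z\bigr)X$. -/

import Mathlib

open scoped ComplexConjugate

noncomputable section

namespace WeightedHardy

/-- A weight sequence `w_1, w_2, …`: positive reals converging to `1`
(the value at index `0` is never used). -/
structure WeightSeq where
  w : ℕ → ℝ
  pos : ∀ k, 1 ≤ k → 0 < w k
  tendsto_one : Filter.Tendsto w Filter.atTop (nhds 1)

/-- `β_0 = 1` and `β_k = w_1 ⋯ w_k`. -/
def WeightSeq.beta (W : WeightSeq) (k : ℕ) : ℝ := ∏ j ∈ Finset.Icc 1 k, W.w j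

/-- `sup_{k ≥ 1} (k + 1) |w_k - 1| < ∞`. -/
def WeightSeq.PolynomialGrowth (W : WeightSeq) : Prop :=
  BddAbove ((fun k : ℕ => ((k : ℝ) + 1) * |W.w k - 1|) '' Set.Ici 1)

theorem WeightSeq.beta_pos (W : WeightSeq) (k : ℕ) : 0 < W.beta k :=
  Finset.prod_pos fun j hj => W.pos j (Finset.mem_Icc.1 hj).1

/-- `c` is the sequence of Taylor coefficients of `f`, whose Taylor series
converges to `f` on the whole open unit disc. -/
def HasTaylor (f : Complex.UnitDisc → ℂ) (c : ℕ → ℂ) : Prop :=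
  ∀ z : Complex.UnitDisc, HasSum (fun k : ℕ => c k * (z : ℂ) ^ k) (f z)

theorem HasTaylor.unique {f : Complex.UnitDisc → ℂ} {c d : ℕ → ℂ}
    (hc : HasTaylor f c) (hd : HasTaylor f d) : c = d := by
  have key : ∀ a : ℕ → ℂ, HasTaylor f a →
      HasFPowerSeriesOnBall (fun z : ℂ => if h : ‖z‖ < 1 then f (Complex.UnitDisc.mk z h) else 0)
        (FormalMultilinearSeries.ofScalars ℂ a) 0 1 := by
    intro a ha
    refine ⟨?_, one_pos, ?_⟩
    · refine ENNReal.le_of_forall_nnreal_lt fun r hr => ?_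
      have hr1 : (r : ℝ) < 1 := by exact_mod_cast hr
      refine FormalMultilinearSeries.le_radius_of_tendsto (l := 0) _ ?_
      have hn : ‖((r : ℝ) : ℂ)‖ < 1 := by simpa using hr1
      have h := (ha (Complex.UnitDisc.mk ((r : ℝ) : ℂ) hn)).summable.tendsto_atTop_zero.norm
      simpa [FormalMultilinearSeries.ofScalars_norm] using h
    · intro y hy
      have hy1 : ‖y‖ < 1 := by
        have := Metric.mem_eball.1 hy
        rw [edist_zero_right, ← ofReal_norm] at this
        exact ENNReal.ofReal_lt_one.1 this
      have h := ha (Complex.UnitDisc.mk y hy1)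
      simpa [hy1, FormalMultilinearSeries.ofScalars_apply_eq, mul_comm] using h
  have h := (key c hc).hasFPowerSeriesAt.eq_formalMultilinearSeries (key d hd).hasFPowerSeriesAt
  exact FormalMultilinearSeries.ofScalars_series_injective ℂ ℂ h

theorem summable_conj_mul {b : ℕ → ℝ} {c d : ℕ → ℂ}
    (hc : Summable fun k => b k ^ 2 * ‖c k‖ ^ 2)
    (hd : Summable fun k => b k ^ 2 * ‖d k‖ ^ 2) :
    Summable fun k => (b k : ℂ) ^ 2 * (conj (c k) * d k) := by
  refine Summable.of_norm_bounded (hc.add hd) fun k => ?_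
  rw [norm_mul, norm_mul, norm_pow, Complex.norm_real, RCLike.norm_conj, Real.norm_eq_abs, sq_abs]
  nlinarith [mul_nonneg (sq_nonneg (b k)) (sq_nonneg (‖c k‖ - ‖d k‖)),
    mul_nonneg (sq_nonneg (b k)) (sq_nonneg (‖c k‖)),
    mul_nonneg (sq_nonneg (b k)) (sq_nonneg (‖d k‖))]

theorem summable_sq_add {b : ℕ → ℝ} {c d : ℕ → ℂ}
    (hc : Summable fun k => b k ^ 2 * ‖c k‖ ^ 2)
    (hd : Summable fun k => b k ^ 2 * ‖d k‖ ^ 2) :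
    Summable fun k => b k ^ 2 * ‖c k + d k‖ ^ 2 := by
  refine Summable.of_nonneg_of_le (fun k => by positivity) (fun k => ?_)
    ((hc.add hd).mul_left 2)
  have h : ‖c k + d k‖ ^ 2 ≤ 2 * (‖c k‖ ^ 2 + ‖d k‖ ^ 2) := by
    nlinarith [norm_add_le (c k) (d k), norm_nonneg (c k + d k), norm_nonneg (c k),
      norm_nonneg (d k), sq_nonneg (‖c k‖ - ‖d k‖)]
  nlinarith [mul_le_mul_of_nonneg_left h (sq_nonneg (b k))]

/-- The weighted Hardy space as a vector space of functions on the open unit disc: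
all `f(z) = ∑ c_k z^k` with `∑ β_k² |c_k|² < ∞`. -/
def hardySubmodule (W : WeightSeq) : Submodule ℂ (Complex.UnitDisc → ℂ) where
  carrier := {f | ∃ c : ℕ → ℂ, HasTaylor f c ∧ Summable fun k => W.beta k ^ 2 * ‖c k‖ ^ 2}
  zero_mem' := ⟨0, fun z => by simp, by simp⟩
  add_mem' := by
    rintro f g ⟨c, hc, hc'⟩ ⟨d, hd, hd'⟩
    exact ⟨c + d, fun z => by simpa [add_mul] using (hc z).add (hd z), summable_sq_add hc' hd'⟩
  smul_mem' := by
    rintro a f ⟨c, hc, hc'⟩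
    refine ⟨a • c, fun z => by simpa [mul_assoc] using (hc z).mul_left a, ?_⟩
    refine (hc'.mul_left (‖a‖ ^ 2)).congr fun k => ?_
    simp only [Pi.smul_apply, smul_eq_mul, norm_mul]
    ring

/-- The weighted Hardy space `H²_β`. It is a type of its own so that it carries the
topology of its norm and not the one of pointwise convergence. -/
def Hardy (W : WeightSeq) : Type := hardySubmodule W

namespace Hardy

variable {W : WeightSeq}

instance : AddCommGroup (Hardy W) := inferInstanceAs (AddCommGroup (hardySubmodule W))

instance : Module ℂ (Hardy W) := inferInstanceAs (Module ℂ (hardySubmodule W))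

instance : CoeFun (Hardy W) fun _ => Complex.UnitDisc → ℂ := ⟨fun f => f.1⟩

/-- The Taylor coefficients of `f`. -/
def coeff (f : Hardy W) : ℕ → ℂ := Classical.choose f.2

theorem hasTaylor (f : Hardy W) : HasTaylor f (coeff f) := (Classical.choose_spec f.2).1

theorem summable_coeff (f : Hardy W) : Summable fun k => W.beta k ^ 2 * ‖coeff f k‖ ^ 2 :=
  (Classical.choose_spec f.2).2

theorem coeff_eq {f : Hardy W} {c : ℕ → ℂ} (h : HasTaylor f c) : coeff f = c :=
  (hasTaylor f).unique h

theorem add_apply (f g : Hardy W) (z : Complex.UnitDisc) : (f + g) z = f z + g z := rfl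

theorem smul_apply (a : ℂ) (f : Hardy W) (z : Complex.UnitDisc) : (a • f) z = a * f z := rfl

theorem coeff_add (f g : Hardy W) : coeff (f + g) = coeff f + coeff g :=
  coeff_eq fun z => by
    simpa [add_mul, add_apply] using (hasTaylor f z).add (hasTaylor g z)

theorem coeff_smul (a : ℂ) (f : Hardy W) : coeff (a • f) = a • coeff f :=
  coeff_eq fun z => by
    simpa [mul_assoc, smul_apply] using (hasTaylor f z).mul_left a

/-- The inner product `∑ β_k² conj(f̂(k)) ĝ(k)`, conjugate-linear in the first
variable, which is Mathlib's convention. -/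
@[reducible] def core (W : WeightSeq) : InnerProductSpace.Core ℂ (Hardy W) where
  inner f g := ∑' k, (W.beta k : ℂ) ^ 2 * (conj (coeff f k) * coeff g k)
  conj_inner_symm f g := by
    rw [Complex.conj_tsum]
    exact tsum_congr fun k => by simp [mul_comm]
  re_inner_nonneg f := by
    have h := summable_conj_mul (summable_coeff f) (summable_coeff f)
    change 0 ≤ (∑' k, (W.beta k : ℂ) ^ 2 * (conj (coeff f k) * coeff f k)).re
    rw [Complex.re_tsum h]
    refine tsum_nonneg fun k => ?_
    rw [Complex.conj_mul']
    norm_cast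
    positivity
  add_left f g h := by
    rw [← (summable_conj_mul (summable_coeff f) (summable_coeff h)).tsum_add
      (summable_conj_mul (summable_coeff g) (summable_coeff h))]
    exact tsum_congr fun k => by simp [coeff_add]; ring
  smul_left f g a := by
    rw [← tsum_mul_left]
    exact tsum_congr fun k => by simp [coeff_smul]; ring
  definite f hf := by
    have e : ∀ k, (W.beta k : ℂ) ^ 2 * (conj (coeff f k) * coeff f k) =
        ((W.beta k ^ 2 * ‖coeff f k‖ ^ 2 : ℝ) : ℂ) := fun k => by
      rw [Complex.conj_mul']
      norm_cast
    have h0 : ∑' k, W.beta k ^ 2 * ‖coeff f k‖ ^ 2 = 0 := by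
      have h := hf
      simp only [e] at h
      exact_mod_cast h
    have h1 := (hasSum_zero_iff_of_nonneg (fun k => by positivity)).1
      (h0 ▸ (summable_coeff f).hasSum)
    have h2 : coeff f = 0 := by
      funext k
      have := congrFun h1 k
      simpa [(W.beta_pos k).ne'] using this
    refine Subtype.ext (funext fun z => ?_)
    have h3 := hasTaylor f z
    rw [h2] at h3
    have h4 : HasSum (fun k : ℕ => (0 : ℕ → ℂ) k * (z : ℂ) ^ k) 0 := by
      simp
    exact h3.unique h4

instance : NormedAddCommGroup (Hardy W) := (core W).toNormedAddCommGroup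

instance : InnerProductSpace ℂ (Hardy W) := InnerProductSpace.ofCore (core W).toCore

/-- `‖f‖² = ∑ β_k² |f̂(k)|²`. -/
theorem norm_sq_eq (f : Hardy W) : ‖f‖ ^ 2 = ∑' k, W.beta k ^ 2 * ‖coeff f k‖ ^ 2 := by
  have h := inner_self_eq_norm_sq_to_K (𝕜 := ℂ) f
  have e : (inner ℂ f f : ℂ) = ((∑' k, W.beta k ^ 2 * ‖coeff f k‖ ^ 2 : ℝ) : ℂ) := by
    change ∑' k, (W.beta k : ℂ) ^ 2 * (conj (coeff f k) * coeff f k) = _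
    rw [Complex.ofReal_tsum]
    refine tsum_congr fun k => ?_
    rw [Complex.conj_mul']
    norm_cast
  rw [e] at h
  refine Complex.ofReal_injective ?_
  rw [h]
  exact Complex.ofReal_pow _ _

end Hardy

/-- The bounded operator `T` on `H²_β` is the multiplication operator `M_φ`. -/
def IsMulOp {W : WeightSeq} (φ : Complex.UnitDisc → ℂ) (T : Hardy W →L[ℂ] Hardy W) : Prop :=
  ∀ (f : Hardy W) (z : Complex.UnitDisc), T f z = φ z * f z

/-- The finite Blaschke product `e^{iθ} ∏_j (a_j - z) / (1 - conj(a_j) z)`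
(zeros may be repeated). -/
def blaschke {m : ℕ} (θ : ℝ) (a : Fin m → Complex.UnitDisc) (z : Complex.UnitDisc) : ℂ :=
  Complex.exp (θ * Complex.I) *
    ∏ j, ((a j : ℂ) - (z : ℂ)) / (1 - conj (a j : ℂ) * (z : ℂ))

/-- The orthogonal direct sum of `m` copies of `T`, acting on the Hilbert space direct sum
of `m` copies of `E`. -/
def directSumOp {E : Type*} [NormedAddCommGroup E] [InnerProductSpace ℂ E] (m : ℕ)
    (T : E →L[ℂ] E) : PiLp 2 (fun _ : Fin m => E) →L[ℂ] PiLp 2 (fun _ : Fin m => E) :=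
  ((PiLp.continuousLinearEquiv 2 ℂ (fun _ : Fin m => E)).symm :
      (Fin m → E) →L[ℂ] PiLp 2 (fun _ : Fin m => E)) ∘L
    ContinuousLinearMap.pi fun j => T ∘L PiLp.proj 2 (fun _ : Fin m => E) j

theorem directSumOp_apply {E : Type*} [NormedAddCommGroup E] [InnerProductSpace ℂ E] (m : ℕ)
    (T : E →L[ℂ] E) (u : PiLp 2 (fun _ : Fin m => E)) (j : Fin m) :
    directSumOp m T u j = T (u j) := rfl

/-- Similarity of bounded operators: `X S = T X` for some bounded invertible `X`
with bounded inverse. -/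
def AreSimilar {E F : Type*} [NormedAddCommGroup E] [InnerProductSpace ℂ E]
    [NormedAddCommGroup F] [InnerProductSpace ℂ F] (S : E →L[ℂ] E) (T : F →L[ℂ] F) : Prop :=
  ∃ X : E ≃L[ℂ] F, ∀ x, X (S x) = T (X x)

end WeightedHardy

end

noncomputable section

open scoped NNReal ENNReal PowerSeries
open PowerSeries (X C coeff)

namespace WeightedHardy

/-! ### Weighted square sums -/

/-! Everything is done with one unitary operator of `ℓ²`. For a Blaschke product `B` of order `m`,
the Takenaka–Malmquist functions with the zeros of `B` repeated periodically satisfy `e_{mk+j} = B^k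
e_j`. When they form an orthonormal basis, the unitary sending the standard basis to it turns the
shift by `m` places into multiplication by `B`. The shift by `m` is the direct sum of `m` unilateral
shifts, one per residue class. It remains to see that this unitary and its inverse respect the
weights: `β_{⌊n/m⌋}²` on the source, which is the norm of the direct sum, and `β_n²` on the target.

For weights `(k+1)^{2s}` with `s` an integer, the unitary acts on a polynomial as a finite sum of
terms `e_j · (p_j ∘ B)`, and each `e_j` is a rational multiplier (`isMultiplier_of_mem_ratAlg`). If
`B(0) = 0`, composition with `B` is contractive for every nonincreasing weight, by Littlewood
subordination (`qsum_aeval_le`). The chain rule raises the exponent two at a time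
(`CompBounded.add_two`), so every even exponent is reached. Since the operator is unitary, a bound
for the weights `u⁻¹, v⁻¹` is dual to a bound for its inverse (`PolyBounded.symm`). As all signs of
`s` are available, both directions follow.

If `B(0) ≠ 0`, the disc automorphism `φ_a` exchanging `0` with a zero `a` of `B` gives the unitary
involution `f ↦ k_a · (f ∘ φ_a)`, where `k_a` is the normalised reproducing kernel. It moves that
zero to the origin and is itself bounded for all even exponents, because `1/φ_a'` is a polynomial
and the chain rule also works downwards (`CompBounded.sub_two`).

Polynomial growth makes `β_k²` comparable with a superposition of weights peaked at points `c`, each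
peak being the minimum of multiples of `(k+1)^s` and `(k+1)^{-s}`. Bounds for these two powers
therefore give the bound for `β²` (`WBounded.interpolate`). Density finally carries the operator
from `ℓ²` to `H²_β`. -/

/-- The weighted square sum `∑ v_k |f_k|²`, with values in `[0, ∞]`. -/
def wsum (v : ℕ → ℝ≥0) (f : ℕ → ℂ) : ℝ≥0∞ := ∑' k, (v k : ℝ≥0∞) * ‖f k‖ₑ ^ 2

theorem wsum_smul (v : ℕ → ℝ≥0) (c : ℂ) (f : ℕ → ℂ) :
    wsum v (c • f) = ‖c‖ₑ ^ 2 * wsum v f := by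
  rw [wsum, wsum, ← ENNReal.tsum_mul_left]
  refine tsum_congr fun k => ?_
  rw [Pi.smul_apply, smul_eq_mul, enorm_mul]
  ring

theorem ennreal_add_sq_le (x y : ℝ≥0∞) : (x + y) ^ 2 ≤ 2 * (x ^ 2 + y ^ 2) := by
  rcases eq_or_ne x ⊤ with rfl | hx
  · simp
  rcases eq_or_ne y ⊤ with rfl | hy
  · simp
  lift x to ℝ≥0 using hx
  lift y to ℝ≥0 using hy
  norm_cast
  exact add_sq_le

theorem wsum_add_le (v : ℕ → ℝ≥0) (f g : ℕ → ℂ) :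
    wsum v (f + g) ≤ 2 * (wsum v f + wsum v g) := by
  rw [wsum, wsum, wsum, ← ENNReal.tsum_add, ← ENNReal.tsum_mul_left]
  refine ENNReal.tsum_le_tsum fun k => ?_
  calc (v k : ℝ≥0∞) * ‖(f + g) k‖ₑ ^ 2
      ≤ v k * (2 * (‖f k‖ₑ ^ 2 + ‖g k‖ₑ ^ 2)) := by
        gcongr
        refine le_trans ?_ (ennreal_add_sq_le _ _)
        gcongr
        exact enorm_add_le _ _
    _ = _ := by ring

theorem wsum_mono {v : ℕ → ℝ≥0} {f g : ℕ → ℂ} (h : ∀ k, ‖f k‖ ≤ ‖g k‖) :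
    wsum v f ≤ wsum v g := by
  refine ENNReal.tsum_le_tsum fun k => ?_
  gcongr
  exact enorm_le_iff_norm_le.2 (h k)

theorem wsum_le_of_weight_le {v w : ℕ → ℝ≥0} {c : ℝ≥0} (h : ∀ k, v k ≤ c * w k) (f : ℕ → ℂ) :
    wsum v f ≤ c * wsum w f := by
  rw [wsum, wsum, ← ENNReal.tsum_mul_left]
  refine ENNReal.tsum_le_tsum fun k => ?_
  rw [← mul_assoc]
  gcongr
  exact_mod_cast h k

theorem wsum_succ (v : ℕ → ℝ≥0) (f : ℕ → ℂ) :
    wsum v f = v 0 * ‖f 0‖ₑ ^ 2 + wsum (fun k => v (k + 1)) (fun k => f (k + 1)) :=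
  tsum_eq_zero_add' ENNReal.summable

theorem wsum_zero (v : ℕ → ℝ≥0) : wsum v 0 = 0 := by simp [wsum]

theorem wsum_sum_le {ι : Type*} (s : Finset ι) :
    ∃ K : ℝ≥0, ∀ (v : ℕ → ℝ≥0) (f : ι → ℕ → ℂ),
      wsum v (∑ i ∈ s, f i) ≤ K * ∑ i ∈ s, wsum v (f i) := by
  classical
  induction s using Finset.induction_on with
  | empty => exact ⟨0, fun v f => by simp [wsum_zero]⟩
  | insert a s ha ih =>
    obtain ⟨K, hK⟩ := ih
    refine ⟨2 * (1 + K), fun v f => ?_⟩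
    rw [Finset.sum_insert ha, Finset.sum_insert ha]
    calc wsum v (f a + ∑ i ∈ s, f i)
        ≤ 2 * (wsum v (f a) + wsum v (∑ i ∈ s, f i)) := wsum_add_le _ _ _
      _ ≤ 2 * (wsum v (f a) + K * ∑ i ∈ s, wsum v (f i)) := by gcongr; exact hK v f
      _ ≤ 2 * ((1 + K) * wsum v (f a) + (1 + K) * ∑ i ∈ s, wsum v (f i)) := by
        gcongr
        · exact le_mul_of_one_le_left' (le_add_right le_rfl)
        · exact le_add_left le_rfl
      _ = _ := by push_cast; ring

/-- The Cauchy–Schwarz inequality for sums in `[0, ∞]`. -/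
theorem ennreal_tsum_mul_sq_le {ι : Type*} (x y : ι → ℝ≥0∞) :
    (∑' i, x i * y i) ^ 2 ≤ (∑' i, x i ^ 2) * ∑' i, y i ^ 2 := by
  have h : ∑' i, x i * y i ≤
      (∑' i, x i ^ 2) ^ (1 / 2 : ℝ) * (∑' i, y i ^ 2) ^ (1 / 2 : ℝ) := by
    rw [ENNReal.tsum_eq_iSup_sum]
    refine iSup_le fun s => ?_
    have := ENNReal.inner_le_Lp_mul_Lq s x y Real.HolderConjugate.two_two
    simp only [ENNReal.rpow_two] at this
    refine this.trans ?_
    gcongr <;> exact ENNReal.sum_le_tsum s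
  calc (∑' i, x i * y i) ^ 2
      ≤ ((∑' i, x i ^ 2) ^ (1 / 2 : ℝ) * (∑' i, y i ^ 2) ^ (1 / 2 : ℝ)) ^ 2 := by gcongr
    _ = _ := by
      rw [mul_pow, ← ENNReal.rpow_natCast, ← ENNReal.rpow_natCast, ← ENNReal.rpow_mul,
        ← ENNReal.rpow_mul]
      norm_num

/-- Weighted square sum of the coefficients of a formal power series. -/
def qsum (v : ℕ → ℝ≥0) (F : ℂ⟦X⟧) : ℝ≥0∞ := wsum v fun k => coeff k F

theorem qsum_add_le (v : ℕ → ℝ≥0) (F G : ℂ⟦X⟧) :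
    qsum v (F + G) ≤ 2 * (qsum v F + qsum v G) := by
  have := wsum_add_le v (fun k => coeff k F) (fun k => coeff k G)
  simpa only [qsum, map_add] using! this

theorem qsum_smul (v : ℕ → ℝ≥0) (c : ℂ) (F : ℂ⟦X⟧) :
    qsum v (c • F) = ‖c‖ₑ ^ 2 * qsum v F := by
  have := wsum_smul v c (fun k => coeff k F)
  simpa only [qsum, map_smul] using! this

theorem qsum_X_mul (v : ℕ → ℝ≥0) (F : ℂ⟦X⟧) :
    qsum v (X * F) = qsum (fun k => v (k + 1)) F := by
  rw [qsum, wsum_succ]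
  simp [qsum, PowerSeries.coeff_succ_X_mul]

/-! ### Multipliers -/

/-- A weight is admissible if `v_{k+i} ≤ c (i+1)^N v_k`. -/
def Admissible (v : ℕ → ℝ≥0) : Prop :=
  ∃ (c : ℝ≥0) (N : ℕ), ∀ k i, v (k + i) ≤ c * (i + 1) ^ N * v k

/-- `g` is a bounded multiplier for the weight `v`. -/
def IsMultiplier (v : ℕ → ℝ≥0) (g : ℂ⟦X⟧) : Prop :=
  ∃ K : ℝ≥0, ∀ F, qsum v (g * F) ≤ K * qsum v F

/-- The geometric series `(1 - a X)⁻¹`. -/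
def geom (a : ℂ) : ℂ⟦X⟧ := PowerSeries.mk fun i => a ^ i

theorem geom_mul_one_sub (a : ℂ) : geom a * (1 - C a * X) = 1 := by
  ext n
  cases n with
  | zero => simp [geom, mul_sub]
  | succ n =>
    rw [mul_sub, ← mul_assoc, map_sub, PowerSeries.coeff_succ_mul_X, mul_one,
      PowerSeries.coeff_mul_C]
    simp [geom, PowerSeries.coeff_one, pow_succ]

theorem summable_geometric_mul_pow {r : ℝ} (h0 : 0 ≤ r) (h1 : r < 1) (N : ℕ) :
    Summable fun i : ℕ => r ^ i * ((i : ℝ) + 1) ^ N := by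
  have hn : ‖r‖ < 1 := by rwa [Real.norm_of_nonneg h0]
  refine Summable.of_nonneg_of_le (fun i => by positivity) (fun i => ?_)
    (((summable_pow_mul_geometric_of_norm_lt_one N hn).add
      (summable_geometric_of_norm_lt_one hn)).mul_left (2 ^ (N - 1)))
  calc r ^ i * ((i : ℝ) + 1) ^ N ≤ r ^ i * (2 ^ (N - 1) * ((i : ℝ) ^ N + 1 ^ N)) := by
        gcongr
        exact add_pow_le (by positivity) zero_le_one N
    _ = _ := by ring

/-- The product is `∑ a^i X^i F`. Multiplication by `X^i` costs only a polynomial factor in `i`,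
which the geometric decay of `a^i` absorbs. Writing `‖a‖^i = ρ^i · ρ^i` leaves a summable half for
each side of Cauchy–Schwarz. -/
theorem isMultiplier_geom {v : ℕ → ℝ≥0} (hv : Admissible v) {a : ℂ} (ha : ‖a‖ < 1) :
    IsMultiplier v (geom a) := by
  obtain ⟨c, N, hc⟩ := hv
  set ρ : ℝ≥0 := NNReal.sqrt ‖a‖₊ with hρ
  have hρ2 : ρ ^ 2 = ‖a‖₊ := NNReal.sq_sqrt _
  have hs : Summable fun i : ℕ => ‖a‖₊ ^ i * (c * ((i : ℝ≥0) + 1) ^ N) := by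
    rw [← NNReal.summable_coe]
    refine ((summable_geometric_mul_pow (norm_nonneg a) ha N).mul_left (c : ℝ)).congr fun i => ?_
    push_cast
    ring
  have hs1 : Summable fun i : ℕ => ‖a‖₊ ^ i :=
    NNReal.summable_geometric (by exact_mod_cast ha)
  refine ⟨(∑' i : ℕ, ‖a‖₊ ^ i) * ∑' i : ℕ, ‖a‖₊ ^ i * (c * ((i : ℝ≥0) + 1) ^ N), fun F => ?_⟩
  -- The modulus of the `k`-th coefficient of `X^i F`.
  set t : ℕ → ℕ → ℝ≥0∞ := fun i k => if i ≤ k then ‖coeff (k - i) F‖ₑ else 0 with ht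
  have h1 : ∀ k, ‖coeff k (geom a * F)‖ₑ ≤ ∑' i, (ρ : ℝ≥0∞) ^ i * ((ρ : ℝ≥0∞) ^ i * t i k) := by
    intro k
    rw [PowerSeries.coeff_mul,
      Finset.Nat.sum_antidiagonal_eq_sum_range_succ (fun i j => coeff i (geom a) * coeff j F)]
    refine (enorm_sum_le _ _).trans (le_trans (Finset.sum_le_sum fun i hi => ?_)
      (ENNReal.sum_le_tsum (Finset.range k.succ)))
    rw [Finset.mem_range, Nat.lt_succ_iff] at hi
    rw [ht, ← mul_assoc, ← mul_pow, ← sq]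
    simp only [hi, if_true]
    rw [enorm_mul]
    gcongr
    rw [geom, PowerSeries.coeff_mk, enorm_pow, ← ENNReal.coe_pow, hρ2, enorm_eq_nnnorm]
  have h2 : ∀ k, ‖coeff k (geom a * F)‖ₑ ^ 2 ≤
      (∑' i, ((ρ : ℝ≥0∞) ^ i) ^ 2) * ∑' i, ((ρ : ℝ≥0∞) ^ i * t i k) ^ 2 := fun k =>
    (pow_le_pow_left' (h1 k) 2).trans (ennreal_tsum_mul_sq_le _ _)
  have hr : ∀ i : ℕ, ((ρ : ℝ≥0∞) ^ i) ^ 2 = ((‖a‖₊ ^ i : ℝ≥0) : ℝ≥0∞) := fun i => by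
    rw [← hρ2]
    push_cast
    ring
  have h3 : ∀ i, ∑' k, (v k : ℝ≥0∞) * t i k ^ 2 ≤
      ((c * ((i : ℝ≥0) + 1) ^ N : ℝ≥0) : ℝ≥0∞) * qsum v F := by
    intro i
    have : ∑' k, (v k : ℝ≥0∞) * t i k ^ 2 = ∑' k, (v (k + i) : ℝ≥0∞) * ‖coeff k F‖ₑ ^ 2 := by
      have hinj := (add_left_injective i).tsum_eq
        (f := fun k => (v k : ℝ≥0∞) * t i k ^ 2) (fun k hk => by
          by_cases hik : i ≤ k
          · exact ⟨k - i, Nat.sub_add_cancel hik⟩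
          · simp [ht, hik] at hk)
      rw [← hinj]
      simp [ht]
    rw [this, qsum, wsum, ← ENNReal.tsum_mul_left]
    refine ENNReal.tsum_le_tsum fun k => ?_
    rw [← mul_assoc]
    gcongr
    exact_mod_cast hc k i
  calc qsum v (geom a * F)
      ≤ ∑' k, (v k : ℝ≥0∞) * ((∑' i, ((ρ : ℝ≥0∞) ^ i) ^ 2) *
          ∑' i, ((ρ : ℝ≥0∞) ^ i * t i k) ^ 2) :=
        ENNReal.tsum_le_tsum fun k => by gcongr; exact h2 k
    _ = (∑' i, ((ρ : ℝ≥0∞) ^ i) ^ 2) *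
          ∑' i, ((ρ : ℝ≥0∞) ^ i) ^ 2 * ∑' k, (v k : ℝ≥0∞) * t i k ^ 2 := by
        simp_rw [mul_left_comm _ (∑' i, ((ρ : ℝ≥0∞) ^ i) ^ 2) _]
        rw [ENNReal.tsum_mul_left]
        congr 1
        simp_rw [← ENNReal.tsum_mul_left]
        rw [ENNReal.tsum_comm]
        refine tsum_congr fun i => tsum_congr fun k => ?_
        ring
    _ ≤ (∑' i, ((ρ : ℝ≥0∞) ^ i) ^ 2) *
          ∑' i : ℕ, ((ρ : ℝ≥0∞) ^ i) ^ 2 *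
            (((c * ((i : ℝ≥0) + 1) ^ N : ℝ≥0) : ℝ≥0∞) * qsum v F) := by
        gcongr with i
        exact h3 i
    _ = _ := by
        have e : ∀ i : ℕ, ((ρ : ℝ≥0∞) ^ i) ^ 2 *
            (((c * ((i : ℝ≥0) + 1) ^ N : ℝ≥0) : ℝ≥0∞) * qsum v F) =
            ((‖a‖₊ ^ i * (c * ((i : ℝ≥0) + 1) ^ N) : ℝ≥0) : ℝ≥0∞) * qsum v F := fun i => by
          rw [hr, ← mul_assoc, ← ENNReal.coe_mul]
        simp_rw [e, hr, ENNReal.tsum_mul_right]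
        rw [← ENNReal.coe_tsum hs1, ← ENNReal.coe_tsum hs, ← mul_assoc, ← ENNReal.coe_mul]

theorem IsMultiplier.mul {v : ℕ → ℝ≥0} {g h : ℂ⟦X⟧} (hg : IsMultiplier v g)
    (hh : IsMultiplier v h) : IsMultiplier v (g * h) := by
  obtain ⟨K, hK⟩ := hg
  obtain ⟨L, hL⟩ := hh
  refine ⟨K * L, fun F => ?_⟩
  rw [mul_assoc, ENNReal.coe_mul, mul_assoc]
  exact (hK _).trans (by gcongr; exact hL F)

theorem IsMultiplier.add {v : ℕ → ℝ≥0} {g h : ℂ⟦X⟧} (hg : IsMultiplier v g)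
    (hh : IsMultiplier v h) : IsMultiplier v (g + h) := by
  obtain ⟨K, hK⟩ := hg
  obtain ⟨L, hL⟩ := hh
  refine ⟨2 * (K + L), fun F => ?_⟩
  rw [add_mul]
  refine (qsum_add_le _ _ _).trans ?_
  push_cast
  rw [mul_assoc, add_mul]
  gcongr
  exacts [hK F, hL F]

theorem isMultiplier_C (v : ℕ → ℝ≥0) (a : ℂ) : IsMultiplier v (C a) :=
  ⟨‖a‖₊ ^ 2, fun F => by
    rw [← PowerSeries.smul_eq_C_mul, qsum_smul, enorm_eq_nnnorm, ENNReal.coe_pow]⟩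

theorem isMultiplier_X {v : ℕ → ℝ≥0} (hv : Admissible v) : IsMultiplier v X := by
  obtain ⟨c, N, hc⟩ := hv
  refine ⟨c * (1 + 1) ^ N, fun F => ?_⟩
  rw [qsum_X_mul]
  exact wsum_le_of_weight_le (fun k => by simpa using hc k 1) _

/-- The algebra of rational functions without poles in the closed unit disc, generated by `X`
and the geometric series `(1 - a X)⁻¹` with `|a| < 1`. -/
def ratAlg : Subalgebra ℂ ℂ⟦X⟧ := Algebra.adjoin ℂ ({X} ∪ {g | ∃ a : ℂ, ‖a‖ < 1 ∧ g = geom a})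

theorem X_mem_ratAlg : X ∈ ratAlg := Algebra.subset_adjoin (Or.inl rfl)

theorem geom_mem_ratAlg {a : ℂ} (ha : ‖a‖ < 1) : geom a ∈ ratAlg :=
  Algebra.subset_adjoin (Or.inr ⟨a, ha, rfl⟩)

theorem C_mem_ratAlg (a : ℂ) : C a ∈ ratAlg := ratAlg.algebraMap_mem a

theorem isMultiplier_of_mem_ratAlg {v : ℕ → ℝ≥0} (hv : Admissible v) {g : ℂ⟦X⟧}
    (hg : g ∈ ratAlg) : IsMultiplier v g := by
  induction hg using Algebra.adjoin_induction with
  | mem g hg =>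
    rcases hg with rfl | ⟨a, ha, rfl⟩
    · exact isMultiplier_X hv
    · exact isMultiplier_geom hv ha
  | algebraMap r => exact isMultiplier_C v r
  | add g h _ _ hg hh => exact hg.add hh
  | mul g h _ _ hg hh => exact hg.mul hh

theorem derivative_geom (a : ℂ) : PowerSeries.derivative ℂ (geom a) = C a * geom a ^ 2 := by
  have h := congrArg (PowerSeries.derivative ℂ) (geom_mul_one_sub a)
  have h1 : PowerSeries.derivative ℂ (1 - C a * X) = -C a := by
    rw [map_sub, Derivation.leibniz]
    simp [smul_eq_mul]
  rw [Derivation.leibniz, h1, PowerSeries.derivative_one, smul_eq_mul, smul_eq_mul] at h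
  calc PowerSeries.derivative ℂ (geom a)
      = geom a * (1 - C a * X) * PowerSeries.derivative ℂ (geom a) := by
        rw [geom_mul_one_sub, one_mul]
    _ = geom a * (geom a * -C a + (1 - C a * X) * PowerSeries.derivative ℂ (geom a))
        + C a * geom a ^ 2 := by ring
    _ = _ := by rw [h]; ring

theorem derivative_mem_ratAlg {g : ℂ⟦X⟧} (hg : g ∈ ratAlg) :
    PowerSeries.derivative ℂ g ∈ ratAlg := by
  induction hg using Algebra.adjoin_induction with
  | mem g hg =>
    rcases hg with rfl | ⟨a, ha, rfl⟩
    · rw [PowerSeries.derivative_X]; exact ratAlg.one_mem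
    · rw [derivative_geom]
      exact ratAlg.mul_mem (C_mem_ratAlg a) (ratAlg.pow_mem (geom_mem_ratAlg ha) 2)
  | algebraMap r =>
    rw [Derivation.map_algebraMap]
    exact ratAlg.zero_mem
  | add g h _ _ hg hh => rw [map_add]; exact ratAlg.add_mem hg hh
  | mul g h hg' hh' hg hh =>
    rw [Derivation.leibniz, smul_eq_mul, smul_eq_mul]
    exact ratAlg.add_mem (ratAlg.mul_mem hg' hh) (ratAlg.mul_mem hh' hg)

/-! ### Power weights -/

/-- The weight `(k + 1) ^ s`. -/
def powWeight (s : ℤ) (k : ℕ) : ℝ≥0 := ((k : ℝ≥0) + 1) ^ s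

theorem powWeight_pos (s : ℤ) (k : ℕ) : 0 < powWeight s k := by
  unfold powWeight; positivity

theorem powWeight_zero_right (s : ℤ) : powWeight s 0 = 1 := by simp [powWeight]

theorem powWeight_neg (s : ℤ) (k : ℕ) : powWeight (-s) k = (powWeight s k)⁻¹ := by
  simp [powWeight, zpow_neg]

/-- For `s ≥ 0` this rests on `k + i + 1 ≤ (i + 1)(k + 1)`; for `s ≤ 0` the weight is nonincreasing.
-/
theorem powWeight_add_le (s : ℤ) (k i : ℕ) :
    powWeight s (k + i) ≤ ((i : ℝ≥0) + 1) ^ s.natAbs * powWeight s k := by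
  obtain ⟨n, rfl | rfl⟩ := s.eq_nat_or_neg
  · simp only [powWeight, Int.natAbs_natCast, zpow_natCast, ← mul_pow]
    gcongr
    push_cast
    have : (i : ℝ≥0) * k ≥ 0 := by positivity
    calc (k : ℝ≥0) + i + 1 ≤ (k + i + 1) + i * k := le_add_right le_rfl
      _ = _ := by ring
  · rw [powWeight_neg, powWeight_neg, Int.natAbs_neg, Int.natAbs_natCast]
    refine le_mul_of_one_le_of_le (one_le_pow₀ (le_add_left le_rfl)) ?_
    refine inv_anti₀ (powWeight_pos _ _) ?_
    simp only [powWeight, zpow_natCast]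
    gcongr
    exact_mod_cast Nat.le_add_right k i

theorem powWeight_le_succ (s : ℤ) (k : ℕ) :
    powWeight s k ≤ 2 ^ s.natAbs * powWeight s (k + 1) := by
  have h := powWeight_add_le (-s) k 1
  rw [powWeight_neg, powWeight_neg, Int.natAbs_neg] at h
  have h1 := powWeight_pos s k
  have h2 := powWeight_pos s (k + 1)
  rw [inv_le_iff_one_le_mul₀ h2, mul_assoc, mul_comm _⁻¹, ← mul_assoc,
    ← div_eq_mul_inv, one_le_div₀ h1] at h
  convert! h using 2
  norm_num

theorem admissible_powWeight (s : ℤ) : Admissible (powWeight s) :=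
  ⟨1, s.natAbs, fun k i => by rw [one_mul]; exact powWeight_add_le s k i⟩

theorem powWeight_add_two (s : ℤ) (k : ℕ) :
    powWeight (s + 2) k = powWeight s k * ((k : ℝ≥0) + 1) ^ 2 := by
  unfold powWeight
  rw [zpow_add₀ (by positivity)]
  norm_cast

/-- Differentiation multiplies the coefficient of index `k + 1` by `k + 1`, hence trades two units
of the exponent. This is why the power weights are treated in steps of two. -/
theorem qsum_derivative (s : ℤ) (F : ℂ⟦X⟧) :
    qsum (powWeight s) (PowerSeries.derivative ℂ F) =
      wsum (powWeight (s + 2)) fun k => coeff (k + 1) F := by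
  refine tsum_congr fun k => ?_
  beta_reduce
  rw [PowerSeries.coeff_derivative, powWeight_add_two, enorm_mul]
  have : ‖(k : ℂ) + 1‖ₑ = ((k : ℝ≥0) + 1 : ℝ≥0) := by
    rw [enorm_eq_nnnorm]
    congr 1
    ext
    have := Complex.norm_natCast (k + 1)
    push_cast at this ⊢
    exact this
  rw [this]
  push_cast
  ring

theorem qsum_derivative_le (s : ℤ) (F : ℂ⟦X⟧) :
    qsum (powWeight s) (PowerSeries.derivative ℂ F) ≤
      ((2 ^ (s + 2).natAbs : ℝ≥0) : ℝ≥0∞) * qsum (powWeight (s + 2)) F := by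
  rw [qsum_derivative, qsum, wsum_succ _ fun k => coeff k F]
  refine (wsum_le_of_weight_le (powWeight_le_succ (s + 2)) _).trans ?_
  gcongr
  exact le_add_self

theorem qsum_le_derivative (s : ℤ) (F : ℂ⟦X⟧) :
    qsum (powWeight (s + 2)) F ≤ ‖coeff 0 F‖ₑ ^ 2 +
      ((2 ^ (s + 2).natAbs : ℝ≥0) : ℝ≥0∞) * qsum (powWeight s) (PowerSeries.derivative ℂ F) := by
  rw [qsum_derivative, qsum, wsum_succ _ fun k => coeff k F, powWeight_zero_right]
  simp only [ENNReal.coe_one, one_mul]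
  gcongr
  refine wsum_le_of_weight_le (fun k => ?_) _
  have := powWeight_add_le (s + 2) k 1
  norm_num at this
  exact this

theorem enorm_coeff_zero_sq_le (s : ℤ) (F : ℂ⟦X⟧) :
    ‖coeff 0 F‖ₑ ^ 2 ≤ qsum (powWeight s) F := by
  rw [qsum, wsum_succ, powWeight_zero_right]
  simp

/-! ### Möbius factors and contractive multipliers -/

/-- The power series of `(a - z) / (1 - conj a z)`. -/
def mobius (a : ℂ) : ℂ⟦X⟧ := (C a - X) * geom (conj a)

theorem mobius_mul_one_sub (a : ℂ) : mobius a * (1 - C (conj a) * X) = C a - X := by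
  rw [mobius, mul_assoc, geom_mul_one_sub, mul_one]

theorem mobius_mem_ratAlg {a : ℂ} (ha : ‖a‖ < 1) : mobius a ∈ ratAlg :=
  ratAlg.mul_mem (ratAlg.sub_mem (C_mem_ratAlg a) X_mem_ratAlg)
    (geom_mem_ratAlg (by rwa [RCLike.norm_conj]))

theorem norm_sq_sub_identity (a x y : ℂ) :
    ‖a * x - y‖ ^ 2 + (1 - ‖a‖ ^ 2) * ‖x‖ ^ 2 =
      ‖x - conj a * y‖ ^ 2 + (1 - ‖a‖ ^ 2) * ‖y‖ ^ 2 := by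
  simp only [Complex.sq_norm, Complex.normSq_apply, Complex.sub_re, Complex.sub_im,
    Complex.mul_re, Complex.mul_im, Complex.conj_re, Complex.conj_im]
  ring

/-- `norm_sq_sub_identity` is summed over the coefficients `x` of `G` and `y` of `X * G`. The gain
or loss under a Möbius factor is thus governed by that of a single shift: a contraction for
nonincreasing weights, an isometry for the constant weight. The identity is additive since the terms
may be infinite. -/
theorem qsum_mobius_identity (v : ℕ → ℝ≥0) {a : ℂ} (ha : ‖a‖ < 1) (G : ℂ⟦X⟧) :
    qsum v ((C a - X) * G) + ((1 - ‖a‖₊ ^ 2 : ℝ≥0) : ℝ≥0∞) * qsum v G =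
      qsum v ((1 - C (conj a) * X) * G) +
        ((1 - ‖a‖₊ ^ 2 : ℝ≥0) : ℝ≥0∞) * qsum v (X * G) := by
  have h1 : ‖a‖₊ ^ 2 ≤ 1 := pow_le_one₀ zero_le (by exact_mod_cast ha.le)
  have key : ∀ x y : ℂ, ‖a * x - y‖₊ ^ 2 + (1 - ‖a‖₊ ^ 2) * ‖x‖₊ ^ 2 =
      ‖x - conj a * y‖₊ ^ 2 + (1 - ‖a‖₊ ^ 2) * ‖y‖₊ ^ 2 := fun x y => by
    ext
    push_cast [NNReal.coe_sub h1]
    exact norm_sq_sub_identity a x y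
  simp only [qsum, wsum, ← ENNReal.tsum_mul_left, ← ENNReal.tsum_add]
  refine tsum_congr fun k => ?_
  have e1 : coeff k ((C a - X) * G) = a * coeff k G - coeff k (X * G) := by
    rw [sub_mul, map_sub, PowerSeries.coeff_C_mul]
  have e2 : coeff k ((1 - C (conj a) * X) * G) = coeff k G - conj a * coeff k (X * G) := by
    rw [sub_mul, map_sub, one_mul, mul_assoc, PowerSeries.coeff_C_mul]
  rw [e1, e2]
  simp only [enorm_eq_nnnorm]
  norm_cast
  rw [mul_left_comm, ← mul_add, key, mul_left_comm _ (v k), ← mul_add]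

theorem qsum_mono_weight {v w : ℕ → ℝ≥0} (h : ∀ k, v k ≤ w k) {F : ℂ⟦X⟧} :
    qsum v F ≤ qsum w F := by
  simpa only [ENNReal.coe_one, one_mul] using! wsum_le_of_weight_le (c := 1)
    (fun k => by simpa using h k) (fun k => coeff k F)

theorem Antitone.admissible {v : ℕ → ℝ≥0} (hv : Antitone v) : Admissible v :=
  ⟨1, 0, fun k i => by simpa using hv (Nat.le_add_right k i)⟩

theorem qsum_mobius_mul_le {v : ℕ → ℝ≥0} (hv : Antitone v) {a : ℂ} (ha : ‖a‖ < 1) (F : ℂ⟦X⟧) :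
    qsum v (mobius a * F) ≤ qsum v F := by
  rcases eq_or_ne (qsum v F) ⊤ with h | h
  · simp [h]
  have ha' : ‖conj a‖ < 1 := by rwa [RCLike.norm_conj]
  set G := geom (conj a) * F with hG
  have hF : (1 - C (conj a) * X) * G = F := by
    rw [hG, ← mul_assoc, mul_comm (1 - _), geom_mul_one_sub, one_mul]
  -- Finiteness is what allows the common term `(1 - ‖a‖²) qsum v G` to be cancelled at the end.
  have hG' : qsum v G ≠ ⊤ := by
    obtain ⟨K, hK⟩ := isMultiplier_geom (Antitone.admissible hv) ha'
    exact ne_top_of_le_ne_top (ENNReal.mul_ne_top ENNReal.coe_ne_top h) (hK F)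
  have hid := qsum_mobius_identity v ha G
  have hX : qsum v (X * G) ≤ qsum v G := by
    rw [qsum_X_mul]
    exact qsum_mono_weight fun k => hv (Nat.le_succ k)
  rw [mobius, mul_assoc, ← hG]
  rw [hF] at hid
  refine (ENNReal.add_le_add_iff_right
    (ENNReal.mul_ne_top (ENNReal.coe_ne_top (r := 1 - ‖a‖₊ ^ 2)) hG')).1 ?_
  rw [hid]
  gcongr

theorem qsum_one_mobius_mul {a : ℂ} (ha : ‖a‖ < 1) {F : ℂ⟦X⟧} (h : qsum 1 F ≠ ⊤) :
    qsum 1 (mobius a * F) = qsum 1 F := by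
  have ha' : ‖conj a‖ < 1 := by rwa [RCLike.norm_conj]
  set G := geom (conj a) * F with hG
  have hF : (1 - C (conj a) * X) * G = F := by
    rw [hG, ← mul_assoc, mul_comm (1 - _), geom_mul_one_sub, one_mul]
  have hG' : qsum 1 G ≠ ⊤ := by
    obtain ⟨K, hK⟩ := isMultiplier_geom (Antitone.admissible (antitone_const (c := 1))) ha'
    exact ne_top_of_le_ne_top (ENNReal.mul_ne_top ENNReal.coe_ne_top h) (hK F)
  have hid := qsum_mobius_identity 1 ha G
  have hX : qsum 1 (X * G) = qsum 1 G := qsum_X_mul _ _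
  rw [hF, hX] at hid
  rw [mobius, mul_assoc, ← hG]
  exact (ENNReal.add_left_inj
    (ENNReal.mul_ne_top (ENNReal.coe_ne_top (r := 1 - ‖a‖₊ ^ 2)) hG')).1 hid

/-- Multiplication by `ψ` is a contraction for every nonincreasing weight. -/
def IsContractive (ψ : ℂ⟦X⟧) : Prop :=
  ∀ v : ℕ → ℝ≥0, Antitone v → ∀ F, qsum v (ψ * F) ≤ qsum v F

theorem isContractive_mobius {a : ℂ} (ha : ‖a‖ < 1) : IsContractive (mobius a) :=
  fun _ hv F => qsum_mobius_mul_le hv ha F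

theorem isContractive_C {c : ℂ} (hc : ‖c‖ ≤ 1) : IsContractive (C c) := fun v _ F => by
  rw [← PowerSeries.smul_eq_C_mul, qsum_smul]
  refine mul_le_of_le_one_left' (pow_le_one₀ zero_le ?_)
  rw [enorm_eq_nnnorm]
  exact_mod_cast hc

theorem IsContractive.mul {ψ χ : ℂ⟦X⟧} (hψ : IsContractive ψ) (hχ : IsContractive χ) :
    IsContractive (ψ * χ) := fun v hv F => by
  rw [mul_assoc]
  exact (hψ v hv _).trans (hχ v hv F)

theorem isContractive_prod {ι : Type*} (s : Finset ι) {ψ : ι → ℂ⟦X⟧}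
    (h : ∀ i ∈ s, IsContractive (ψ i)) : IsContractive (∏ i ∈ s, ψ i) :=
  Finset.prod_induction _ _ (fun _ _ => IsContractive.mul) (fun v _ F => by rw [one_mul]) h

/-! ### Composition of polynomials with a power series -/

/-- Littlewood's subordination principle for nonincreasing weights. -/
theorem qsum_aeval_le {ψ : ℂ⟦X⟧} (hψ : IsContractive ψ) (p : Polynomial ℂ) :
    ∀ v : ℕ → ℝ≥0, Antitone v →
      qsum v (Polynomial.aeval (X * ψ) p) ≤ qsum v (p : ℂ⟦X⟧) := by
  induction p using Polynomial.recOnHorner with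
  | M0 => intro v _; simp
  -- Since `X * ψ` has no constant term, neither has the composition with `p`. The constant `a` is
  -- then orthogonal to the rest on both sides and contributes the same amount.
  | MC p a hp _ ih =>
    intro v hv
    have h0 : coeff 0 (Polynomial.aeval (X * ψ) p) = 0 := by
      obtain ⟨q, rfl⟩ := Polynomial.X_dvd_iff.2 hp
      simp
    have split : ∀ F : ℂ⟦X⟧, coeff 0 F = 0 →
        qsum v (F + C a) = v 0 * ‖a‖ₑ ^ 2 + qsum v F := fun F hF => by
      rw [qsum, qsum, wsum_succ v (fun k => coeff k (F + C a)),
        wsum_succ v (fun k => coeff k F)]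
      simp only [map_add, hF, PowerSeries.coeff_C, Nat.succ_ne_zero, if_false, if_true,
        zero_add, add_zero, enorm_zero]
      ring
    have e : Polynomial.aeval (X * ψ) (Polynomial.C a) = C a := Polynomial.aeval_C _ _
    rw [map_add, e, split _ h0, Polynomial.coe_add, Polynomial.coe_C,
      split _ (by simpa using hp)]
    gcongr
    exact ih v hv
  -- The factor `X` shifts the weight, which stays nonincreasing, and `ψ` contracts for the shifted
  -- weight. The induction hypothesis is needed for that new weight, hence the quantifier over `v`
  -- inside the induction.
  | MX p _ ih =>
    intro v hv
    have hv' : Antitone fun k => v (k + 1) := fun i j hij => hv (by omega)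
    rw [map_mul, Polynomial.aeval_X, Polynomial.coe_mul, Polynomial.coe_X, mul_comm, mul_assoc,
      mul_comm _ X, qsum_X_mul, qsum_X_mul]
    exact (hψ _ hv' _).trans (ih _ hv')

/-- Composition with `B` is bounded on polynomials for the weight `(k + 1) ^ s`. -/
def CompBounded (B : ℂ⟦X⟧) (s : ℤ) : Prop :=
  ∃ K : ℝ≥0, ∀ p : Polynomial ℂ,
    qsum (powWeight s) (Polynomial.aeval B p) ≤ K * qsum (powWeight s) (p : ℂ⟦X⟧)

theorem antitone_powWeight {s : ℤ} (hs : s ≤ 0) : Antitone (powWeight s) := by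
  obtain ⟨n, hn⟩ := Int.eq_ofNat_of_zero_le (neg_nonneg.2 hs)
  obtain rfl : s = -(n : ℤ) := by omega
  intro i j hij
  rw [powWeight_neg, powWeight_neg]
  refine inv_anti₀ (powWeight_pos _ _) ?_
  simp only [powWeight, zpow_natCast]
  gcongr

theorem compBounded_of_nonpos {ψ : ℂ⟦X⟧} (hψ : IsContractive ψ) {s : ℤ} (hs : s ≤ 0) :
    CompBounded (X * ψ) s :=
  ⟨1, fun p => by simpa using qsum_aeval_le hψ p _ (antitone_powWeight hs)⟩

theorem derivative_aeval (B : ℂ⟦X⟧) (p : Polynomial ℂ) :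
    PowerSeries.derivative ℂ (Polynomial.aeval B p) =
      PowerSeries.derivative ℂ B * Polynomial.aeval B (Polynomial.derivative p) := by
  rw [Derivation.map_aeval, smul_eq_mul, mul_comm]

theorem powWeight_le_add_two (s : ℤ) (k : ℕ) : powWeight s k ≤ powWeight (s + 2) k := by
  rw [powWeight_add_two]
  exact le_mul_of_one_le_right zero_le (one_le_pow₀ (le_add_left le_rfl))

/-- By the chain rule `(p ∘ B)' = B' · (p' ∘ B)`, where `B'` is a multiplier and `p'` has exponent
`s`. The constant term lost by differentiation is controlled by the bound for `s` applied to `p`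
itself. -/
theorem CompBounded.add_two {B : ℂ⟦X⟧} (hB : B ∈ ratAlg) {s : ℤ} (h : CompBounded B s) :
    CompBounded B (s + 2) := by
  obtain ⟨K, hK⟩ := h
  obtain ⟨M, hM⟩ := isMultiplier_of_mem_ratAlg (admissible_powWeight s) (derivative_mem_ratAlg hB)
  set c : ℝ≥0 := 2 ^ (s + 2).natAbs with hc
  refine ⟨K + c * M * K * c, fun p => ?_⟩
  calc qsum (powWeight (s + 2)) (Polynomial.aeval B p)
      ≤ ‖coeff 0 (Polynomial.aeval B p)‖ₑ ^ 2 +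
        c * qsum (powWeight s) (PowerSeries.derivative ℂ (Polynomial.aeval B p)) :=
        qsum_le_derivative s _
    _ ≤ K * qsum (powWeight (s + 2)) (p : ℂ⟦X⟧) +
        c * (M * (K * (c * qsum (powWeight (s + 2)) (p : ℂ⟦X⟧)))) := by
        gcongr
        · refine (enorm_coeff_zero_sq_le s _).trans ((hK p).trans ?_)
          gcongr
          exact qsum_mono_weight (powWeight_le_add_two s)
        · rw [derivative_aeval]
          refine (hM _).trans ?_
          gcongr
          refine (hK _).trans ?_
          gcongr
          rw [← PowerSeries.derivative_coe]
          exact qsum_derivative_le s _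
    _ = _ := by push_cast; ring

/-- The point is that `1 / φ_a'` is a polynomial, so division by `φ_a'` is a bounded operation. -/
theorem derivative_mobius_mul (a : ℂ) :
    PowerSeries.derivative ℂ (mobius a) * (1 - C (conj a) * X) ^ 2 = C ((‖a‖ : ℂ) ^ 2 - 1) := by
  have h := congrArg (PowerSeries.derivative ℂ) (mobius_mul_one_sub a)
  have h1 : PowerSeries.derivative ℂ (1 - C (conj a) * X) = -C (conj a) := by
    rw [map_sub, Derivation.leibniz]
    simp [smul_eq_mul]
  rw [Derivation.leibniz, h1, map_sub, PowerSeries.derivative_C, PowerSeries.derivative_X,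
    smul_eq_mul, smul_eq_mul] at h
  have h2 : C ((‖a‖ : ℂ) ^ 2 - 1) = C a * C (conj a) - 1 := by
    rw [← map_mul, Complex.mul_conj', map_sub, map_one]
  rw [h2]
  linear_combination (1 - C (conj a) * X) * h + C (conj a) * mobius_mul_one_sub a

theorem exists_polynomial_antiderivative (p : Polynomial ℂ) :
    ∃ P : Polynomial ℂ, Polynomial.derivative P = p ∧ P.coeff 0 = 0 := by
  induction p using Polynomial.induction_on' with
  | add p q hp hq =>
    obtain ⟨P, hP, hP0⟩ := hp
    obtain ⟨Q, hQ, hQ0⟩ := hq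
    exact ⟨P + Q, by rw [Polynomial.derivative_add, hP, hQ], by simp [hP0, hQ0]⟩
  | monomial n a =>
    refine ⟨Polynomial.monomial (n + 1) (a / (n + 1)), ?_, by simp [Polynomial.coeff_monomial]⟩
    rw [Polynomial.derivative_monomial]
    congr 1
    push_cast
    exact div_mul_cancel₀ _ (by exact_mod_cast Nat.succ_ne_zero n)

/-- With `p = P'`, the chain rule reads `p ∘ φ_a = (P ∘ φ_a)' / φ_a'`, and the division is harmless.
A Blaschke product of higher order has critical points in the disc, so this descent is special to
Möbius factors. -/
theorem CompBounded.sub_two {a : ℂ} (ha : ‖a‖ < 1) {s : ℤ} (h : CompBounded (mobius a) (s + 2)) :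
    CompBounded (mobius a) s := by
  obtain ⟨K, hK⟩ := h
  set d : ℂ := (‖a‖ : ℂ) ^ 2 - 1 with hd
  have hd0 : d ≠ 0 := by
    rw [hd, sub_ne_zero]
    have : ‖a‖ ^ 2 < 1 := by nlinarith [norm_nonneg a]
    exact_mod_cast this.ne
  have hg : C d⁻¹ * (1 - C (conj a) * X) ^ 2 ∈ ratAlg :=
    ratAlg.mul_mem (C_mem_ratAlg _) (ratAlg.pow_mem (ratAlg.sub_mem ratAlg.one_mem
      (ratAlg.mul_mem (C_mem_ratAlg _) X_mem_ratAlg)) 2)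
  obtain ⟨M, hM⟩ := isMultiplier_of_mem_ratAlg (admissible_powWeight s) hg
  set c : ℝ≥0 := 2 ^ (s + 2).natAbs with hc
  refine ⟨M * c * K * c, fun p => ?_⟩
  obtain ⟨P, rfl, hP0⟩ := exists_polynomial_antiderivative p
  have e : Polynomial.aeval (mobius a) (Polynomial.derivative P) =
      C d⁻¹ * (1 - C (conj a) * X) ^ 2 *
        PowerSeries.derivative ℂ (Polynomial.aeval (mobius a) P) := by
    rw [derivative_aeval]
    have h1 : C d⁻¹ * C d = (1 : ℂ⟦X⟧) := by rw [← map_mul, inv_mul_cancel₀ hd0, map_one]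
    linear_combination (-Polynomial.aeval (mobius a) (Polynomial.derivative P)) * h1 -
      C d⁻¹ * Polynomial.aeval (mobius a) (Polynomial.derivative P) * derivative_mobius_mul a
  calc qsum (powWeight s) (Polynomial.aeval (mobius a) (Polynomial.derivative P))
      ≤ M * qsum (powWeight s) (PowerSeries.derivative ℂ (Polynomial.aeval (mobius a) P)) := by
        rw [e]; exact hM _
    _ ≤ M * (c * (K * (c * qsum (powWeight s) (Polynomial.derivative P : ℂ⟦X⟧)))) := by
        gcongr
        refine (qsum_derivative_le s _).trans ?_
        gcongr
        refine (hK P).trans ?_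
        gcongr
        rw [← PowerSeries.derivative_coe]
        refine (qsum_le_derivative s _).trans ?_
        rw [Polynomial.coeff_coe, hP0]
        simp [hc]
    _ = _ := by push_cast; ring

theorem compBounded_two_mul {ψ : ℂ⟦X⟧} (hψ : IsContractive ψ) (hψ' : ψ ∈ ratAlg) (n : ℤ) :
    CompBounded (X * ψ) (2 * n) := by
  rcases le_or_gt n 0 with hn | hn
  · exact compBounded_of_nonpos hψ (by omega)
  · lift n to ℕ using hn.le
    clear hn
    induction n with
    | zero => exact compBounded_of_nonpos hψ (by simp)
    | succ n ih =>
      have := ih.add_two (ratAlg.mul_mem X_mem_ratAlg hψ')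
      rwa [show 2 * ((n + 1 : ℕ) : ℤ) = 2 * n + 2 by push_cast; ring]

/-- Subordination is not available because `φ_a` need not fix the origin. Both signs are reached
from exponent `0`, upwards and downwards. -/
theorem compBounded_mobius {a : ℂ} (ha : ‖a‖ < 1) (h : CompBounded (mobius a) 0) (n : ℤ) :
    CompBounded (mobius a) (2 * n) := by
  induction n using Int.induction_on with
  | zero => exact h
  | succ n ih =>
    rw [show 2 * ((n : ℤ) + 1) = 2 * n + 2 by ring]
    exact ih.add_two (mobius_mem_ratAlg ha)
  | pred n ih =>
    refine CompBounded.sub_two ha ?_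
    rwa [show 2 * (-(n : ℤ) - 1) + 2 = 2 * -n by ring]

/-! ### The space `ℓ²` as a space of power series -/

/-- The Hilbert space `ℓ²(ℕ)`. -/
abbrev H2 : Type := lp (fun _ : ℕ => ℂ) 2

/-- The power series with coefficients in `ℓ²`. -/
def series : H2 →ₗ[ℂ] ℂ⟦X⟧ where
  toFun f := PowerSeries.mk f
  map_add' f g := by
    ext k
    rw [map_add, PowerSeries.coeff_mk, PowerSeries.coeff_mk, PowerSeries.coeff_mk]
    rfl
  map_smul' c f := by
    ext k
    rw [map_smul, PowerSeries.coeff_mk, PowerSeries.coeff_mk]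
    rfl

@[simp] theorem coeff_series (f : H2) (k : ℕ) : coeff k (series f) = f k :=
  PowerSeries.coeff_mk _ _

theorem series_injective : Function.Injective series := fun f g h => by
  ext k
  rw [← coeff_series, h, coeff_series]

theorem qsum_series (v : ℕ → ℝ≥0) (f : H2) : qsum v (series f) = wsum v f := by
  simp [qsum]

theorem enorm_sq_eq_ofReal {E : Type*} [NormedAddCommGroup E] (x : E) :
    ‖x‖ₑ ^ 2 = ENNReal.ofReal (‖x‖ ^ 2) := by
  rw [ENNReal.ofReal_pow (norm_nonneg _), ofReal_norm]

theorem wsum_one_eq (f : H2) : wsum 1 f = ‖f‖ₑ ^ 2 := by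
  have h := lp.hasSum_norm (p := 2) (by norm_num) f
  norm_num at h
  rw [enorm_sq_eq_ofReal, ← h.tsum_eq,
    ENNReal.ofReal_tsum_of_nonneg (fun _ => by positivity) h.summable]
  refine tsum_congr fun k => ?_
  rw [Pi.one_apply, ENNReal.coe_one, one_mul, enorm_sq_eq_ofReal]

theorem qsum_one_series (f : H2) : qsum 1 (series f) = ‖f‖ₑ ^ 2 := by
  rw [qsum_series, wsum_one_eq]

theorem qsum_one_series_ne_top (f : H2) : qsum 1 (series f) ≠ ⊤ := by
  rw [qsum_one_series]
  exact ENNReal.pow_ne_top enorm_ne_top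

theorem summable_of_wsum_ne_top {v : ℕ → ℝ≥0} {f : ℕ → ℂ} (h : wsum v f ≠ ⊤) :
    Summable fun k => (v k : ℝ) * ‖f k‖ ^ 2 := by
  have : Summable fun k => v k * ‖f k‖₊ ^ 2 := by
    rw [← ENNReal.tsum_coe_ne_top_iff_summable]
    simpa [wsum, enorm_eq_nnnorm] using h
  refine (NNReal.summable_coe.2 this).congr fun k => ?_
  push_cast
  rfl

theorem exists_series_eq {F : ℂ⟦X⟧} (h : qsum 1 F ≠ ⊤) : ∃ f : H2, series f = F := by
  have hm : Memℓp (fun k => coeff k F) 2 := by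
    refine memℓp_gen ?_
    simpa using summable_of_wsum_ne_top h
  exact ⟨⟨_, hm⟩, by ext k; rw [coeff_series]⟩

/-- The element of `ℓ²` with a given power series (zero if there is none). -/
def ofSeries (F : ℂ⟦X⟧) : H2 := Function.invFun series F

theorem series_ofSeries {F : ℂ⟦X⟧} (h : qsum 1 F ≠ ⊤) : series (ofSeries F) = F :=
  Function.invFun_eq (exists_series_eq h)

theorem admissible_one : Admissible 1 := ⟨1, 0, fun k i => by simp⟩

theorem qsum_one_mul_ne_top {g F : ℂ⟦X⟧} (hg : g ∈ ratAlg) (h : qsum 1 F ≠ ⊤) :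
    qsum 1 (g * F) ≠ ⊤ := by
  obtain ⟨K, hK⟩ := isMultiplier_of_mem_ratAlg admissible_one hg
  exact ne_top_of_le_ne_top (ENNReal.mul_ne_top ENNReal.coe_ne_top h) (hK F)

theorem series_ofSeries_mul (g : ratAlg) (f : H2) :
    series (ofSeries (g.1 * series f)) = g.1 * series f :=
  series_ofSeries (qsum_one_mul_ne_top g.2 (qsum_one_series_ne_top _))

/-- Multiplication by `g` on `ℓ²`. -/
def mulH (g : ratAlg) : H2 →L[ℂ] H2 :=
  LinearMap.mkContinuousOfExistsBound
    { toFun := fun f => ofSeries (g.1 * series f)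
      map_add' := fun f h => series_injective <| by
        rw [series_ofSeries_mul, map_add, map_add, series_ofSeries_mul, series_ofSeries_mul,
          mul_add]
      map_smul' := fun c f => series_injective <| by
        rw [series_ofSeries_mul, map_smul, map_smul, series_ofSeries_mul, mul_smul_comm]
        rfl } <| by
    obtain ⟨K, hK⟩ := isMultiplier_of_mem_ratAlg admissible_one g.2
    refine ⟨(NNReal.sqrt K : ℝ), fun f => ?_⟩
    have h := hK (series f)
    rw [← series_ofSeries_mul, qsum_one_series, qsum_one_series] at h
    simp only [enorm_eq_nnnorm] at h
    norm_cast at h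
    have h2 : ‖ofSeries (g.1 * series f)‖₊ ≤ NNReal.sqrt K * ‖f‖₊ := by
      rw [← NNReal.sqrt_sq ‖f‖₊, ← NNReal.sqrt_mul]
      exact NNReal.le_sqrt_iff_sq_le.2 h
    exact NNReal.coe_le_coe.2 h2

theorem series_mulH (g : ratAlg) (f : H2) : series (mulH g f) = g.1 * series f :=
  series_ofSeries_mul g f

/-- Multiplication by `g` preserves the norm of `ℓ²`. -/
def IsInner (g : ratAlg) : Prop := ∀ f : H2, ‖mulH g f‖ = ‖f‖

theorem mulH_mul (g h : ratAlg) (f : H2) : mulH (g * h) f = mulH g (mulH h f) :=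
  series_injective <| by simp [series_mulH, mul_assoc]

theorem IsInner.mul {g h : ratAlg} (hg : IsInner g) (hh : IsInner h) : IsInner (g * h) :=
  fun f => by rw [mulH_mul, hg, hh]

theorem isInner_one : IsInner 1 := fun f => by
  congr 1
  exact series_injective (by simp [series_mulH])

theorem IsInner.inner_eq {g : ratAlg} (hg : IsInner g) (f h : H2) :
    inner ℂ (mulH g f) (mulH g h) = inner ℂ f h :=
  (LinearIsometry.mk (mulH g : H2 →ₗ[ℂ] H2) hg).inner_map_map f h

/-- The Blaschke factor `c (a - z) / (1 - conj a z)`. -/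
def factor (c : ℂ) (a : Complex.UnitDisc) : ratAlg :=
  ⟨C c * mobius a, ratAlg.mul_mem (C_mem_ratAlg c) (mobius_mem_ratAlg a.norm_lt_one)⟩

theorem coe_factor (c : ℂ) (a : Complex.UnitDisc) :
    (factor c a : ℂ⟦X⟧) = C c * mobius a := rfl

theorem isInner_factor {c : ℂ} (hc : ‖c‖ = 1) (a : Complex.UnitDisc) : IsInner (factor c a) :=
  fun f => by
    have h1 : ‖c‖ₑ = 1 := by rw [← ofReal_norm, hc, ENNReal.ofReal_one]
    have h : ‖mulH (factor c a) f‖ₑ ^ 2 = ‖f‖ₑ ^ 2 := by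
      rw [← qsum_one_series, series_mulH, coe_factor, mul_assoc, ← PowerSeries.smul_eq_C_mul,
        qsum_smul, qsum_one_mobius_mul a.norm_lt_one (qsum_one_series_ne_top f),
        qsum_one_series, h1, one_pow, one_mul]
    simp only [enorm_eq_nnnorm] at h
    norm_cast at h
    have h' : ‖mulH (factor c a) f‖₊ = ‖f‖₊ := by
      exact (pow_left_inj₀ zero_le zero_le two_ne_zero).1 h
    exact congrArg NNReal.toReal h'

/-- The normalised reproducing kernel at `a`. -/
def kernel (a : ℂ) : ℂ⟦X⟧ := C ((√(1 - ‖a‖ ^ 2) : ℝ) : ℂ) * geom (conj a)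

theorem kernel_mem_ratAlg {a : ℂ} (ha : ‖a‖ < 1) : kernel a ∈ ratAlg :=
  ratAlg.mul_mem (C_mem_ratAlg _) (geom_mem_ratAlg (by rwa [RCLike.norm_conj]))

theorem coeff_kernel (a : ℂ) (k : ℕ) :
    coeff k (kernel a) = ((√(1 - ‖a‖ ^ 2) : ℝ) : ℂ) * conj a ^ k := by
  rw [kernel, PowerSeries.coeff_C_mul, geom, PowerSeries.coeff_mk]

theorem qsum_one_kernel {a : ℂ} (ha : ‖a‖ < 1) : qsum 1 (kernel a) = 1 := by
  have h0 : ‖a‖ ^ 2 < 1 := by nlinarith [norm_nonneg a]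
  have hs := (hasSum_geometric_of_lt_one (by positivity) h0).mul_left (1 - ‖a‖ ^ 2)
  rw [mul_inv_cancel₀ (by linarith)] at hs
  have e : ∀ k, ‖coeff k (kernel a)‖ₑ ^ 2 = ENNReal.ofReal ((1 - ‖a‖ ^ 2) * (‖a‖ ^ 2) ^ k) :=
    fun k => by
      rw [← ofReal_norm, ← ENNReal.ofReal_pow (norm_nonneg _), coeff_kernel, norm_mul, mul_pow,
        Complex.norm_real, Real.norm_eq_abs, sq_abs, Real.sq_sqrt (by linarith), norm_pow,
        RCLike.norm_conj]
      congr 2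
      ring
  rw [qsum, wsum]
  simp only [Pi.one_apply, ENNReal.coe_one, one_mul, e]
  rw [← ENNReal.ofReal_tsum_of_nonneg (fun k => mul_nonneg (by linarith) (by positivity))
    hs.summable, hs.tsum_eq, ENNReal.ofReal_one]

/-- The normalised reproducing kernel at `a` as a vector of `ℓ²`. -/
def kernelH (a : Complex.UnitDisc) : H2 := ofSeries (kernel a)

theorem series_kernelH (a : Complex.UnitDisc) : series (kernelH a) = kernel a :=
  series_ofSeries (by rw [qsum_one_kernel a.norm_lt_one]; simp)

theorem norm_kernelH (a : Complex.UnitDisc) : ‖kernelH a‖ = 1 := by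
  have h : ‖kernelH a‖ₑ ^ 2 = 1 := by
    rw [← qsum_one_series, series_kernelH, qsum_one_kernel a.norm_lt_one]
  rw [enorm_eq_nnnorm] at h
  norm_cast at h
  have : ‖kernelH a‖₊ = 1 := (pow_eq_one_iff_of_nonneg zero_le two_ne_zero).1 h
  simpa using congrArg NNReal.toReal this

/-- Pairing with the kernel at `a` is evaluation at `a` up to a scalar, and the Blaschke factor
vanishes there. On coefficients this is a telescoping sum whose boundary term tends to `0` because
`‖a‖ < 1`. -/
theorem inner_kernelH_mulH_factor (a : Complex.UnitDisc) (c : ℂ) (h : H2) :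
    inner ℂ (kernelH a) (mulH (factor c a) h) = 0 := by
  have hg : geom (conj (a : ℂ)) ∈ ratAlg :=
    geom_mem_ratAlg (by rw [RCLike.norm_conj]; exact a.norm_lt_one)
  set u := mulH ⟨_, hg⟩ h with hu
  have hsum := lp.hasSum_inner (𝕜 := ℂ) (kernelH a) (mulH (factor c a) h)
  set s : ℂ := ((√(1 - ‖(a : ℂ)‖ ^ 2) : ℝ) : ℂ) with hs
  set t : ℕ → ℂ := fun k => s * c * ((a : ℂ) ^ k * coeff k (X * series u)) with ht
  have e : ∀ k, inner ℂ (kernelH a k) (mulH (factor c a) h k) = t (k + 1) - t k := by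
    intro k
    have e1 : mulH (factor c a) h k = c * ((a : ℂ) * u k - coeff k (X * series u)) := by
      rw [← coeff_series, ← coeff_series u, series_mulH, coe_factor, mobius, hu, series_mulH]
      have : C c * ((C (a : ℂ) - X) * geom (conj (a : ℂ))) * series h =
          C c * (C (a : ℂ) * (geom (conj (a : ℂ)) * series h) -
            X * (geom (conj (a : ℂ)) * series h)) := by ring
      rw [this, PowerSeries.coeff_C_mul, map_sub, PowerSeries.coeff_C_mul]
    rw [e1, ← coeff_series (kernelH a), series_kernelH, coeff_kernel, ht]
    simp only [PowerSeries.coeff_succ_X_mul, coeff_series, RCLike.inner_apply, map_mul, map_pow,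
      Complex.conj_conj]
    rw [← hs, hs, Complex.conj_ofReal]
    ring
  simp_rw [e] at hsum
  have h1 := hsum.tendsto_sum_nat
  simp_rw [Finset.sum_range_sub] at h1
  have t0 : t 0 = 0 := by simp [ht]
  have ht0 : Filter.Tendsto t Filter.atTop (nhds 0) := by
    rw [← Filter.tendsto_add_atTop_iff_nat 1]
    have hb : ∀ k, ‖t (k + 1)‖ ≤ ‖s * c‖ * ‖u‖ * ‖(a : ℂ)‖ ^ (k + 1) := by
      intro k
      rw [ht]
      simp only [PowerSeries.coeff_succ_X_mul, coeff_series]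
      rw [norm_mul (s * c), norm_mul ((a : ℂ) ^ (k + 1)), norm_pow]
      have := lp.norm_apply_le_norm (p := 2) (by norm_num) u k
      calc ‖s * c‖ * (‖(a : ℂ)‖ ^ (k + 1) * ‖u k‖)
          ≤ ‖s * c‖ * (‖(a : ℂ)‖ ^ (k + 1) * ‖u‖) := by gcongr
        _ = _ := by ring
    refine squeeze_zero_norm hb ?_
    have := (tendsto_pow_atTop_nhds_zero_of_lt_one (norm_nonneg (a : ℂ)) a.norm_lt_one)
    simpa using ((Filter.tendsto_add_atTop_iff_nat 1).2 this).const_mul (‖s * c‖ * ‖u‖)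
  rw [t0] at h1
  simpa using tendsto_nhds_unique h1 (ht0.sub_const 0)

/-! ### Takenaka–Malmquist systems -/

/-- The partial products of a sequence of Blaschke factors. -/
def partialProd (c : ℕ → ℂ) (a : ℕ → Complex.UnitDisc) (n : ℕ) : ratAlg :=
  ∏ i ∈ Finset.range n, factor (c i) (a i)

theorem isInner_prod {ι : Type*} (s : Finset ι) {g : ι → ratAlg} (h : ∀ i ∈ s, IsInner (g i)) :
    IsInner (∏ i ∈ s, g i) :=
  Finset.prod_induction _ _ (fun _ _ => IsInner.mul) isInner_one h

/-- The Takenaka–Malmquist system of the zeros `a`. -/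
def malmquist (c : ℕ → ℂ) (a : ℕ → Complex.UnitDisc) (n : ℕ) : H2 :=
  mulH (partialProd c a n) (kernelH (a n))

section Malmquist

variable {c : ℕ → ℂ} (hc : ∀ i, ‖c i‖ = 1) (a : ℕ → Complex.UnitDisc)
include hc

theorem isInner_partialProd (n : ℕ) : IsInner (partialProd c a n) :=
  isInner_prod _ fun i _ => isInner_factor (hc i) (a i)

/-- The first `i` factors are common and isometric, so they cancel. What remains pairs the kernel at
`a i` with a multiple of the factor vanishing at `a i`. -/
theorem inner_malmquist_of_lt {i n : ℕ} (h : i < n) :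
    inner ℂ (malmquist c a i) (malmquist c a n) = 0 := by
  have e : partialProd c a n =
      partialProd c a i * (factor (c i) (a i) * ∏ l ∈ Finset.Ico (i + 1) n, factor (c l) (a l)) := by
    rw [← mul_assoc, partialProd, partialProd, ← Finset.prod_range_succ,
      Finset.prod_range_mul_prod_Ico _ h]
  rw [malmquist, malmquist, e, mulH_mul, (isInner_partialProd hc a i).inner_eq, mulH_mul]
  exact inner_kernelH_mulH_factor _ _ _

theorem orthonormal_malmquist : Orthonormal ℂ (malmquist c a) := by
  refine ⟨fun n => ?_, fun i n hin => ?_⟩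
  · rw [malmquist, isInner_partialProd hc a n, norm_kernelH]
  · rcases lt_or_gt_of_ne hin with h | h
    · exact inner_malmquist_of_lt hc a h
    · rw [inner_eq_zero_symm]
      exact inner_malmquist_of_lt hc a h

end Malmquist

/-! ### Polynomials in `ℓ²` -/

theorem qsum_one_polynomial_ne_top (p : Polynomial ℂ) : qsum 1 (p : ℂ⟦X⟧) ≠ ⊤ := by
  rw [qsum, wsum, tsum_eq_sum (s := p.support) fun k hk => by
    simp [Polynomial.notMem_support_iff.1 hk]]
  exact ENNReal.sum_ne_top.2 fun k _ =>
    ENNReal.mul_ne_top ENNReal.coe_ne_top (ENNReal.pow_ne_top enorm_ne_top)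

/-- The vector of coefficients of a polynomial. -/
def polyH (p : Polynomial ℂ) : H2 := ofSeries (p : ℂ⟦X⟧)

theorem series_polyH (p : Polynomial ℂ) : series (polyH p) = p :=
  series_ofSeries (qsum_one_polynomial_ne_top p)

theorem polyH_add (p q : Polynomial ℂ) : polyH (p + q) = polyH p + polyH q :=
  series_injective <| by rw [map_add, series_polyH, series_polyH, series_polyH, Polynomial.coe_add]

/-- The unit vectors of `ℓ²`. -/
abbrev unitVec (k : ℕ) : H2 := lp.single 2 k (1 : ℂ)

theorem series_unitVec (k : ℕ) : series (unitVec k) = X ^ k := by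
  ext n
  rw [coeff_series, PowerSeries.coeff_X_pow, unitVec, lp.single_apply]
  split_ifs with h
  · subst h; simp
  · simp [h]

theorem polyH_monomial (k : ℕ) (c : ℂ) : polyH (Polynomial.monomial k c) = c • unitVec k :=
  series_injective <| by
    rw [series_polyH, map_smul, series_unitVec, Polynomial.coe_monomial, PowerSeries.smul_eq_C_mul,
      PowerSeries.monomial_eq_C_mul_X_pow]

theorem H2.hasSum_unitVec (f : H2) : HasSum (fun k => f k • unitVec k) f := by
  have := lp.hasSum_single (p := 2) (by norm_num) f
  have e : (fun k => f k • unitVec k) = fun k => lp.single (E := fun _ => ℂ) 2 k (f k) := by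
    funext k
    rw [unitVec, ← lp.single_smul, smul_eq_mul, mul_one]
  rwa [e]

theorem H2.clm_ext {E : Type*} [NormedAddCommGroup E] [NormedSpace ℂ E] {A B : H2 →L[ℂ] E}
    (h : ∀ k, A (unitVec k) = B (unitVec k)) : A = B := by
  ext1 f
  have hA := (H2.hasSum_unitVec f).mapL A
  have hB := (H2.hasSum_unitVec f).mapL B
  simp only [map_smul, h] at hA hB
  exact hA.unique hB

/-! ### The unitary involution attached to a point of the disc -/

/-- The automorphism `z ↦ (a - z) / (1 - conj a z)` of the disc. -/
def discInv (a c : ℂ) : ℂ := (a - c) / (1 - conj a * c)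

theorem one_sub_conj_mul_ne_zero {a c : ℂ} (ha : ‖a‖ < 1) (hc : ‖c‖ < 1) :
    1 - conj a * c ≠ 0 := by
  intro h
  have : ‖conj a * c‖ = 1 := by rw [← sub_eq_zero.1 h, norm_one]
  rw [norm_mul, RCLike.norm_conj] at this
  nlinarith [norm_nonneg a, norm_nonneg c]

theorem norm_discInv_lt_one {a c : ℂ} (ha : ‖a‖ < 1) (hc : ‖c‖ < 1) : ‖discInv a c‖ < 1 := by
  have h0 := one_sub_conj_mul_ne_zero ha hc
  rw [discInv, norm_div, div_lt_one (norm_pos_iff.2 h0)]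
  have h := norm_sq_sub_identity a 1 c
  have h1 : ‖a * 1 - c‖ ^ 2 < ‖1 - conj a * c‖ ^ 2 := by
    rw [norm_one] at h
    nlinarith [norm_nonneg a, norm_nonneg c, mul_pos (sub_pos.2 ha) (sub_pos.2 hc),
      mul_pos (by nlinarith [norm_nonneg a] : 0 < 1 - ‖a‖ ^ 2)
        (by nlinarith [norm_nonneg c] : 0 < 1 - ‖c‖ ^ 2)]
  rw [mul_one] at h1
  exact lt_of_pow_lt_pow_left₀ 2 (norm_nonneg _) h1

/-- The isometry `f ↦ kernel a * f ∘ mobius a` of `ℓ²`. -/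
def moebIso (a : Complex.UnitDisc) : H2 →ₗᵢ[ℂ] H2 :=
  -- With all zeros equal to `a` the Malmquist system is `kernel a * mobius a ^ k`, the images of
  -- the monomials.
  (orthonormal_malmquist (c := fun _ => 1) (by simp) fun _ => a).orthogonalFamily.linearIsometry

theorem moebIso_unitVec (a : Complex.UnitDisc) (k : ℕ) :
    moebIso a (unitVec k) = malmquist (fun _ => 1) (fun _ => a) k := by
  rw [moebIso, OrthogonalFamily.linearIsometry_apply_single]
  simp

theorem series_moebIso_unitVec (a : Complex.UnitDisc) (k : ℕ) :
    series (moebIso a (unitVec k)) = kernel a * mobius a ^ k := by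
  rw [moebIso_unitVec, malmquist, series_mulH, series_kernelH, partialProd, Finset.prod_const,
    Finset.card_range]
  push_cast
  rw [coe_factor, map_one, one_mul, mul_comm]

theorem series_moebIso_polyH (a : Complex.UnitDisc) (p : Polynomial ℂ) :
    series (moebIso a (polyH p)) = kernel a * Polynomial.aeval (mobius a) p := by
  induction p using Polynomial.induction_on' with
  | add p q hp hq => rw [polyH_add, map_add, map_add, hp, hq, map_add, mul_add]
  | monomial k c =>
    rw [polyH_monomial, map_smul, map_smul, series_moebIso_unitVec, Polynomial.aeval_monomial,
      PowerSeries.smul_eq_C_mul, mul_left_comm]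
    rfl

/-- The unilateral shift. -/
def shiftMul : ratAlg := ⟨X, X_mem_ratAlg⟩

theorem mulH_shiftMul_unitVec (k : ℕ) : mulH shiftMul (unitVec k) = unitVec (k + 1) :=
  series_injective <| by
    rw [series_mulH, series_unitVec, series_unitVec, pow_succ']
    rfl

/-- For `a ≠ 0` the series `mobius a` has a nonzero constant term and cannot be substituted formally
into an arbitrary series. The relation is checked on unit vectors and extended by continuity. -/
theorem series_moebIso_shift (a : Complex.UnitDisc) (f : H2) :
    series (moebIso a (mulH shiftMul f)) = mobius a * series (moebIso a f) := by
  have h : (moebIso a).toContinuousLinearMap ∘L mulH shiftMul =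
      mulH (factor 1 a) ∘L (moebIso a).toContinuousLinearMap := by
    refine H2.clm_ext fun k => series_injective ?_
    simp only [ContinuousLinearMap.comp_apply, LinearIsometry.coe_toContinuousLinearMap]
    rw [mulH_shiftMul_unitVec, series_moebIso_unitVec, series_mulH, series_moebIso_unitVec,
      coe_factor, map_one, one_mul]
    ring
  have h1 := congrArg series (DFunLike.congr_fun h f)
  simp only [ContinuousLinearMap.comp_apply, LinearIsometry.coe_toContinuousLinearMap] at h1
  rw [h1, series_mulH, coe_factor, map_one, one_mul]

/-- `moebIso a` intertwines Blaschke factors, up to unimodular constants. -/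
theorem series_moebIso_mobius_mul (a d : Complex.UnitDisc) {c : ℂ} (hc : c = discInv a d)
    {g h : H2} (hgh : series h = mobius c * series g) :
    series (moebIso a h) = C (-((1 - conj (d : ℂ) * a) / (1 - conj (a : ℂ) * d))) *
      (mobius d * series (moebIso a g)) := by
  -- The hypothesis is cleared of its denominator. Only multiplication by `X` is then left, which
  -- `moebIso a` turns into multiplication by `mobius a`.
  have hH : h - conj c • mulH shiftMul h = c • g - mulH shiftMul g := series_injective <| by
    rw [map_sub, map_sub, map_smul, map_smul, series_mulH, series_mulH, hgh,
      PowerSeries.smul_eq_C_mul, PowerSeries.smul_eq_C_mul]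
    change _ - _ * (X * _) = _ - X * _
    linear_combination series g * mobius_mul_one_sub c
  have E := congrArg (fun x => series (moebIso a x)) hH
  simp only [map_sub, map_smul, series_moebIso_shift, PowerSeries.smul_eq_C_mul] at E
  have h0 := one_sub_conj_mul_ne_zero a.norm_lt_one d.norm_lt_one
  have h0' := one_sub_conj_mul_ne_zero d.norm_lt_one a.norm_lt_one
  have h1 := one_sub_conj_mul_ne_zero a.norm_lt_one a.norm_lt_one
  have s2 : (1 - conj (a : ℂ) * d) * c = a - d := by
    rw [hc, discInv, mul_div_cancel₀ _ h0]
  have s1 : (1 - conj (d : ℂ) * a) * conj c = conj (a : ℂ) - conj (d : ℂ) := by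
    have := congrArg conj s2
    simpa [mul_comm] using this
  have S1 := congrArg (C (R := ℂ)) s1
  have S2 := congrArg (C (R := ℂ)) s2
  simp only [map_mul, map_sub, map_one] at S1 S2
  have T := mobius_mul_one_sub (a : ℂ)
  have M := mobius_mul_one_sub (d : ℂ)
  set P := series (moebIso a h)
  set Q := series (moebIso a g)
  have F : P * ((1 - C (conj (a : ℂ)) * X) - C (conj c) * (C (a : ℂ) - X)) =
      Q * (C c * (1 - C (conj (a : ℂ)) * X) - (C (a : ℂ) - X)) := by
    linear_combination (1 - C (conj (a : ℂ)) * X) * E + (C (conj c) * P - Q) * T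
  have G : (C (1 - conj (a : ℂ) * a) * (1 - C (conj (d : ℂ)) * X)) *
      (C (1 - conj (a : ℂ) * d) * P + C (1 - conj (d : ℂ) * a) * (mobius d * Q)) = 0 := by
    simp only [map_mul, map_sub, map_one]
    linear_combination (1 - C (conj (a : ℂ)) * C (d : ℂ)) * (1 - C (conj (d : ℂ)) * C (a : ℂ)) * F +
      (1 - C (conj (a : ℂ)) * C (d : ℂ)) * P * (C (a : ℂ) - X) * S1 +
      (1 - C (conj (a : ℂ)) * C (a : ℂ)) * (1 - C (conj (d : ℂ)) * C (a : ℂ)) * Q * M +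
      (1 - C (conj (d : ℂ)) * C (a : ℂ)) * Q * (1 - C (conj (a : ℂ)) * X) * S2
  have hne : C (1 - conj (a : ℂ) * a) * (1 - C (conj (d : ℂ)) * X) ≠ 0 := by
    refine mul_ne_zero ((map_ne_zero_iff _ PowerSeries.C_injective).2 h1) fun h => ?_
    simpa using congrArg PowerSeries.constantCoeff h
  have G' := (mul_eq_zero.1 G).resolve_left hne
  have e : C (-((1 - conj (d : ℂ) * a) / (1 - conj (a : ℂ) * d))) * C (1 - conj (a : ℂ) * d) =
      -C (1 - conj (d : ℂ) * a) := by
    rw [← map_mul, neg_mul, div_mul_cancel₀ _ h0, map_neg]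
  refine mul_left_cancel₀ (a := C (1 - conj (a : ℂ) * d)) ((map_ne_zero_iff _ PowerSeries.C_injective).2 h0) ?_
  linear_combination G' - (mobius d * Q) * e

theorem mobius_zero : mobius 0 = -X := by
  have h := mobius_mul_one_sub 0
  simpa using h

/-- Analytically, `φ_a ∘ φ_a = id` and `k_a · (k_a ∘ φ_a) = 1`. Here the square fixes the constant
`1` and commutes with the shift, so it fixes every unit vector. -/
theorem moebIso_moebIso (a : Complex.UnitDisc) (f : H2) : moebIso a (moebIso a f) = f := by
  have hk : moebIso a (moebIso a (unitVec 0)) = unitVec 0 := by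
    set s : ℂ := ((√(1 - ‖(a : ℂ)‖ ^ 2) : ℝ) : ℂ) with hs
    have hss : s * s = 1 - conj (a : ℂ) * a := by
      rw [hs, ← Complex.ofReal_mul, Real.mul_self_sqrt, Complex.conj_mul']
      · push_cast; ring
      · nlinarith [a.norm_lt_one, norm_nonneg (a : ℂ)]
    set u := moebIso a (unitVec 0) with hu
    have hus : series u = kernel a := by rw [hu, series_moebIso_unitVec, pow_zero, mul_one]
    have hker : kernel (a : ℂ) * (1 - C (conj (a : ℂ)) * X) = C s := by
      rw [kernel, mul_assoc, geom_mul_one_sub, mul_one]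
    have hH : u - conj (a : ℂ) • mulH shiftMul u = s • unitVec 0 := series_injective <| by
      rw [map_sub, map_smul, map_smul, series_mulH, hus, series_unitVec,
        PowerSeries.smul_eq_C_mul, PowerSeries.smul_eq_C_mul, pow_zero]
      change _ - _ * (X * _) = _
      linear_combination hker
    have E := congrArg (fun x => series (moebIso a x)) hH
    simp only [map_sub, map_smul, series_moebIso_shift, PowerSeries.smul_eq_C_mul] at E
    rw [← hu, hus] at E
    have T := mobius_mul_one_sub (a : ℂ)
    have hss' := congrArg (C (R := ℂ)) hss
    simp only [map_mul, map_sub, map_one] at hss'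
    have h1 := one_sub_conj_mul_ne_zero a.norm_lt_one a.norm_lt_one
    refine series_injective ?_
    rw [series_unitVec, pow_zero]
    refine mul_left_cancel₀ (a := C (1 - conj (a : ℂ) * a)) ((map_ne_zero_iff _ PowerSeries.C_injective).2 h1) ?_
    simp only [map_mul, map_sub, map_one]
    linear_combination (1 - C (conj (a : ℂ)) * X) * E +
      C (conj (a : ℂ)) * series (moebIso a u) * T + C s * hker + hss'
  -- The case `d = 0`: then `discInv a 0 = a`, and the unimodular constant `-1` cancels the sign in
  -- `mobius 0 = -X`.
  have hS : ∀ g, moebIso a (moebIso a (mulH shiftMul g)) =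
      mulH shiftMul (moebIso a (moebIso a g)) := fun g => series_injective <| by
    rw [series_moebIso_mobius_mul a 0 (c := a) (by simp [discInv]) (series_moebIso_shift a g),
      series_mulH, Complex.UnitDisc.coe_zero, mobius_zero]
    simp [shiftMul]
  have h : (moebIso a).toContinuousLinearMap ∘L (moebIso a).toContinuousLinearMap =
      ContinuousLinearMap.id ℂ H2 := by
    refine H2.clm_ext fun k => ?_
    simp only [ContinuousLinearMap.comp_apply, LinearIsometry.coe_toContinuousLinearMap,
      ContinuousLinearMap.id_apply]
    induction k with
    | zero => exact hk
    | succ k ih => rw [← mulH_shiftMul_unitVec, hS, ih]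
  exact DFunLike.congr_fun h f

/-- `moebIso a` as a unitary operator. -/
def moebUnitary (a : Complex.UnitDisc) : H2 ≃ₗᵢ[ℂ] H2 where
  __ := LinearEquiv.ofInvolutive (moebIso a).toLinearMap (moebIso_moebIso a)
  norm_map' f := (moebIso a).norm_map f

theorem moebUnitary_apply (a : Complex.UnitDisc) (f : H2) : moebUnitary a f = moebIso a f := rfl

theorem moebIso_unitVec_zero (a : Complex.UnitDisc) : moebIso a (unitVec 0) = kernelH a :=
  series_injective <| by rw [series_moebIso_unitVec, series_kernelH, pow_zero, mul_one]

/-- A vector orthogonal to the kernel at `a` is divisible by the Blaschke factor of `a`. -/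
theorem exists_eq_mulH_factor {a : Complex.UnitDisc} {c : ℂ} (hc : ‖c‖ = 1) {f : H2}
    (h : inner ℂ (kernelH a) f = 0) : ∃ g, f = mulH (factor c a) g := by
  -- The involution carries evaluation at `a` to the constant coefficient, so the divisibility
  -- question becomes divisibility by `X`.
  have h0 : moebIso a f 0 = 0 := by
    rw [← moebIso_unitVec_zero, ← (moebIso a).inner_map_map, moebIso_moebIso,
      lp.inner_single_left] at h
    simpa using h
  obtain ⟨F, hF⟩ := PowerSeries.X_dvd_iff.2
    (by rw [← PowerSeries.coeff_zero_eq_constantCoeff_apply, coeff_series, h0] :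
      PowerSeries.constantCoeff (series (moebIso a f)) = 0)
  have hF1 : qsum 1 F ≠ ⊤ := by
    have := qsum_one_series_ne_top (moebIso a f)
    rwa [hF, qsum_X_mul] at this
  obtain ⟨y, rfl⟩ := exists_series_eq hF1
  have hy : moebIso a f = mulH shiftMul y := series_injective <| by
    rw [hF, series_mulH, shiftMul]
  have hc0 : c ≠ 0 := by rintro rfl; simp at hc
  refine ⟨c⁻¹ • moebIso a y, series_injective ?_⟩
  rw [← moebIso_moebIso a f, hy, series_moebIso_shift, map_smul, map_smul, series_mulH, coe_factor,
    mul_comm (C c), mul_assoc, PowerSeries.smul_eq_C_mul, ← mul_assoc _ (mobius _),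
    mul_comm _ (mobius _), mul_assoc, ← mul_assoc (C _) (C _), ← map_mul, inv_mul_cancel₀ hc0,
    map_one, one_mul]

/-! ### Completeness of Takenaka–Malmquist systems -/

/-- Each orthogonality relation splits off one more factor: the product already extracted is
isometric and drops out of the inner product. -/
theorem exists_eq_mulH_partialProd {c : ℕ → ℂ} (hc : ∀ i, ‖c i‖ = 1) {a : ℕ → Complex.UnitDisc}
    {f : H2} (h : ∀ n, inner ℂ (malmquist c a n) f = 0) (n : ℕ) :
    ∃ g, f = mulH (partialProd c a n) g := by
  induction n with
  | zero => exact ⟨f, series_injective (by simp [series_mulH, partialProd])⟩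
  | succ n ih =>
    obtain ⟨g, rfl⟩ := ih
    have := h n
    rw [malmquist, (isInner_partialProd hc a n).inner_eq] at this
    obtain ⟨g', rfl⟩ := exists_eq_mulH_factor (hc n) this
    exact ⟨g', by rw [partialProd, partialProd, Finset.prod_range_succ, mulH_mul]⟩

/-- Each zero at the origin supplies a factor `X`. A vector divisible by all partial products then
has no nonzero coefficient, which gives completeness. -/
theorem X_pow_dvd_partialProd {c : ℕ → ℂ} {a : ℕ → Complex.UnitDisc}
    (ha : ∀ n, ∃ i ≥ n, a i = 0) (k : ℕ) :
    ∃ n, (X : ℂ⟦X⟧) ^ k ∣ (partialProd c a n : ℂ⟦X⟧) := by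
  induction k with
  | zero => exact ⟨0, by simp⟩
  | succ k ih =>
    obtain ⟨n, hn⟩ := ih
    obtain ⟨i, hi, h0⟩ := ha n
    refine ⟨i + 1, ?_⟩
    rw [partialProd, Finset.prod_range_succ]
    push_cast
    rw [pow_succ]
    refine mul_dvd_mul ?_ ?_
    · refine hn.trans ?_
      rw [partialProd]
      push_cast
      exact Finset.prod_dvd_prod_of_subset _ _ _ (Finset.range_mono hi)
    · rw [coe_factor, h0, Complex.UnitDisc.coe_zero, mobius_zero]
      exact Dvd.intro_left (-C (c i)) (by ring)

/-- A Takenaka–Malmquist system with infinitely many zeros at the origin is a basis. -/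
def malmquistBasis {c : ℕ → ℂ} (hc : ∀ i, ‖c i‖ = 1) {a : ℕ → Complex.UnitDisc}
    (ha : ∀ n, ∃ i ≥ n, a i = 0) : HilbertBasis ℕ ℂ H2 :=
  HilbertBasis.mkOfOrthogonalEqBot (orthonormal_malmquist hc a) <| by
    rw [Submodule.eq_bot_iff]
    intro f hf
    have hf' : ∀ n, inner ℂ (malmquist c a n) f = 0 := fun n =>
      (Submodule.mem_orthogonal _ _).1 hf _ (Submodule.subset_span ⟨n, rfl⟩)
    refine series_injective (PowerSeries.ext fun k => ?_)
    obtain ⟨n, hn⟩ := X_pow_dvd_partialProd (c := c) ha (k + 1)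
    obtain ⟨g, rfl⟩ := exists_eq_mulH_partialProd hc hf' n
    rw [series_mulH, map_zero, map_zero]
    exact PowerSeries.X_pow_dvd_iff.1 (hn.mul_right _) k (Nat.lt_succ_self k)

/-- The unitary operator sending the standard basis to a Takenaka–Malmquist basis. -/
def malmquistUnitary {c : ℕ → ℂ} (hc : ∀ i, ‖c i‖ = 1) {a : ℕ → Complex.UnitDisc}
    (ha : ∀ n, ∃ i ≥ n, a i = 0) : H2 ≃ₗᵢ[ℂ] H2 :=
  (malmquistBasis hc ha).repr.symm

theorem malmquistUnitary_unitVec {c : ℕ → ℂ} (hc : ∀ i, ‖c i‖ = 1) {a : ℕ → Complex.UnitDisc}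
    (ha : ∀ n, ∃ i ≥ n, a i = 0) (n : ℕ) :
    malmquistUnitary hc ha (unitVec n) = malmquist c a n := by
  rw [malmquistUnitary, unitVec, HilbertBasis.repr_symm_single, malmquistBasis,
    HilbertBasis.coe_mkOfOrthogonalEqBot]

/-! ### Bounds for power weights -/

/-- The linear map `T` is bounded from the weight `u` to the weight `v`. -/
def WBounded (T : H2 →ₗ[ℂ] H2) (u v : ℕ → ℝ≥0) : Prop :=
  ∃ K : ℝ≥0, ∀ f : H2, wsum v (T f) ≤ K * wsum u f

/-- The linear map `T` is bounded from the weight `u` to the weight `v` on polynomials. -/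
def PolyBounded (T : H2 →ₗ[ℂ] H2) (u v : ℕ → ℝ≥0) : Prop :=
  ∃ K : ℝ≥0, ∀ p : Polynomial ℂ, wsum v (T (polyH p)) ≤ K * wsum u (polyH p)

theorem WBounded.polyBounded {T : H2 →ₗ[ℂ] H2} {u v : ℕ → ℝ≥0} (h : WBounded T u v) :
    PolyBounded T u v := h.imp fun _ hK _ => hK _

theorem WBounded.trans {Φ Ψ : H2 ≃ₗᵢ[ℂ] H2} {u v w : ℕ → ℝ≥0}
    (hΦ : WBounded Φ.toLinearEquiv u v) (hΨ : WBounded Ψ.toLinearEquiv v w) :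
    WBounded (Φ.trans Ψ).toLinearEquiv u w := by
  obtain ⟨K, hK⟩ := hΦ
  obtain ⟨L, hL⟩ := hΨ
  refine ⟨L * K, fun f => ?_⟩
  change wsum w (Ψ (Φ f)) ≤ _
  refine (hL _).trans ?_
  rw [ENNReal.coe_mul, mul_assoc]
  gcongr
  exact hK f

theorem powWeight_zero_left : powWeight 0 = 1 := by
  funext k
  simp [powWeight]

/-- Composition is the isometry `moebIso a` followed by division by the kernel, and the reciprocal
of the kernel is a polynomial, hence a multiplier. -/
theorem compBounded_mobius_zero (a : Complex.UnitDisc) : CompBounded (mobius a) 0 := by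
  set s : ℂ := ((√(1 - ‖(a : ℂ)‖ ^ 2) : ℝ) : ℂ) with hs
  have hs0 : s ≠ 0 := by
    have : 0 < √(1 - ‖(a : ℂ)‖ ^ 2) :=
      Real.sqrt_pos.2 (by nlinarith [a.norm_lt_one, norm_nonneg (a : ℂ)])
    rw [hs]
    exact_mod_cast this.ne'
  have hg : C s⁻¹ * (1 - C (conj (a : ℂ)) * X) ∈ ratAlg :=
    ratAlg.mul_mem (C_mem_ratAlg _) (ratAlg.sub_mem ratAlg.one_mem
      (ratAlg.mul_mem (C_mem_ratAlg _) X_mem_ratAlg))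
  obtain ⟨K, hK⟩ := isMultiplier_of_mem_ratAlg admissible_one hg
  refine ⟨K, fun p => ?_⟩
  have e : Polynomial.aeval (mobius (a : ℂ)) p =
      C s⁻¹ * (1 - C (conj (a : ℂ)) * X) * series (moebIso a (polyH p)) := by
    have h1 : C s⁻¹ * C s = (1 : ℂ⟦X⟧) := by rw [← map_mul, inv_mul_cancel₀ hs0, map_one]
    rw [series_moebIso_polyH, kernel, ← hs]
    linear_combination (-Polynomial.aeval (mobius (a : ℂ)) p) * h1 -
      (C s⁻¹ * C s * Polynomial.aeval (mobius (a : ℂ)) p) * geom_mul_one_sub (conj (a : ℂ))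
  rw [powWeight_zero_left, e]
  refine (hK _).trans ?_
  rw [qsum_one_series, ← series_polyH p, qsum_one_series, enorm_eq_nnnorm, enorm_eq_nnnorm,
    LinearIsometry.nnnorm_map]

theorem polyBounded_moebUnitary (a : Complex.UnitDisc) (n : ℤ) :
    PolyBounded (moebUnitary a).toLinearEquiv (powWeight (2 * n)) (powWeight (2 * n)) := by
  obtain ⟨K, hK⟩ := compBounded_mobius a.norm_lt_one (compBounded_mobius_zero a) n
  obtain ⟨M, hM⟩ := isMultiplier_of_mem_ratAlg (admissible_powWeight (2 * n))
    (kernel_mem_ratAlg a.norm_lt_one)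
  refine ⟨M * K, fun p => ?_⟩
  change wsum _ (moebIso a (polyH p)) ≤ _
  rw [← qsum_series, ← qsum_series, series_moebIso_polyH, series_polyH, ENNReal.coe_mul, mul_assoc]
  refine (hM _).trans ?_
  gcongr
  exact hK p

/-- Duality: a bound for a unitary operator gives a bound for its inverse and the
reciprocal weights. -/
theorem PolyBounded.symm {Ψ : H2 ≃ₗᵢ[ℂ] H2} {u v : ℕ → ℝ≥0} (hu : ∀ k, 0 < u k)
    (hv : ∀ k, 0 < v k) (h : PolyBounded Ψ.toLinearEquiv u⁻¹ v⁻¹) :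
    WBounded Ψ.symm.toLinearEquiv v u := by
  obtain ⟨K, hK⟩ := h
  refine ⟨K, fun g => ?_⟩
  set f := Ψ.symm g with hf
  change wsum u f ≤ _
  rw [wsum, ENNReal.tsum_eq_iSup_nat]
  refine iSup_le fun n => ?_
  set A : ℝ≥0∞ := ∑ k ∈ Finset.range n, (u k : ℝ≥0∞) * ‖f k‖ₑ ^ 2 with hA
  have hAtop : A ≠ ⊤ := ENNReal.sum_ne_top.2 fun k _ =>
    ENNReal.mul_ne_top ENNReal.coe_ne_top (ENNReal.pow_ne_top enorm_ne_top)
  -- The extremal test vector: the truncation of `u · f`. Its square sum for `u⁻¹` and its pairing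
  -- with `f` both equal `A`, so Cauchy–Schwarz gives `A² ≤ K A · wsum v g`. Being a polynomial, it
  -- needs only the bound on polynomials.
  set p : Polynomial ℂ := ∑ k ∈ Finset.range n, Polynomial.monomial k ((u k : ℂ) * f k) with hp
  have hpk : ∀ k, polyH p k = if k < n then (u k : ℂ) * f k else 0 := fun k => by
    rw [← coeff_series, series_polyH, Polynomial.coeff_coe, hp, Polynomial.finsetSum_coeff]
    simp [Polynomial.coeff_monomial]
  have hpA : wsum u⁻¹ (polyH p) = A := by
    rw [wsum, tsum_eq_sum (s := Finset.range n) fun k hk => by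
      rw [hpk, if_neg (by simpa using hk)]; simp]
    refine Finset.sum_congr rfl fun k hk => ?_
    rw [hpk, if_pos (Finset.mem_range.1 hk), enorm_mul]
    have : ‖((u k : ℝ≥0) : ℂ)‖ₑ = u k := by
      rw [enorm_eq_nnnorm]; congr 1; ext; simp
    simp only [this, Pi.inv_apply, enorm_eq_nnnorm]
    norm_cast
    field_simp [(hu k).ne']
  have hinner : inner ℂ (polyH p) f = ((A.toReal : ℝ) : ℂ) := by
    rw [lp.inner_eq_tsum, tsum_eq_sum (s := Finset.range n) fun k hk => by
      rw [hpk, if_neg (by simpa using hk), inner_zero_left], hA,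
      ENNReal.toReal_sum fun k _ =>
        ENNReal.mul_ne_top ENNReal.coe_ne_top (ENNReal.pow_ne_top enorm_ne_top)]
    push_cast
    refine Finset.sum_congr rfl fun k hk => ?_
    rw [hpk, if_pos (Finset.mem_range.1 hk), RCLike.inner_apply, map_mul, mul_left_comm,
      Complex.mul_conj']
    have : conj ((u k : ℝ≥0) : ℂ) = ((u k : ℝ≥0) : ℂ) := Complex.conj_ofReal _
    rw [this]
    simp
  have h1 : A ≤ ∑' k, ‖Ψ (polyH p) k‖ₑ * ‖g k‖ₑ := by
    have e : A = ‖(inner ℂ (polyH p) f : ℂ)‖ₑ := by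
      rw [hinner, ← ofReal_norm, Complex.norm_real, Real.norm_of_nonneg ENNReal.toReal_nonneg,
        ENNReal.ofReal_toReal hAtop]
    rw [e, ← Ψ.inner_map_map, hf, Ψ.apply_symm_apply, lp.inner_eq_tsum]
    refine (enorm_tsum_le_tsum_enorm).trans (ENNReal.tsum_le_tsum fun k => ?_)
    rw [RCLike.inner_apply, enorm_mul, mul_comm, RCLike.enorm_conj]
  have h2 : A ^ 2 ≤ K * A * wsum v g := by
    calc A ^ 2 ≤ (∑' k, ‖Ψ (polyH p) k‖ₑ * ‖g k‖ₑ) ^ 2 := by gcongr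
      _ ≤ wsum v⁻¹ (Ψ (polyH p)) * wsum v g := by
        have e : ∀ k, ‖Ψ (polyH p) k‖ₑ * ‖g k‖ₑ =
            (((NNReal.sqrt (v k))⁻¹ : ℝ≥0) * ‖Ψ (polyH p) k‖ₑ) *
              ((NNReal.sqrt (v k) : ℝ≥0) * ‖g k‖ₑ) := fun k => by
          have hr : NNReal.sqrt (v k) ≠ 0 := (NNReal.sqrt_pos.2 (hv k)).ne'
          simp only [enorm_eq_nnnorm]
          norm_cast
          field_simp
        simp_rw [e]
        refine (ennreal_tsum_mul_sq_le _ _).trans_eq ?_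
        congr 1 <;> refine tsum_congr fun k => ?_
        · rw [mul_pow, ← ENNReal.coe_pow, inv_pow, NNReal.sq_sqrt]
          rfl
        · rw [mul_pow, ← ENNReal.coe_pow, NNReal.sq_sqrt]
      _ ≤ _ := by
        gcongr
        rw [← hpA]
        exact hK p
  rcases eq_or_ne A 0 with h0 | h0
  · rw [h0]; exact zero_le
  · rw [sq, mul_assoc, mul_left_comm] at h2
    exact (ENNReal.mul_le_mul_iff_right h0 hAtop).1 h2

/-! ### Interpolation between power weights -/

theorem exists_split (f : H2) (P : ℕ → Prop) [DecidablePred P] :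
    ∃ g h : H2, f = g + h ∧ (∀ k, g k = if P k then f k else 0) ∧
      ∀ k, h k = if P k then 0 else f k := by
  have key : ∀ e : ℕ → ℂ, (∀ k, ‖e k‖ ≤ ‖f k‖) → ∃ g : H2, ∀ k, g k = e k := fun e he => by
    have h1 : qsum 1 (PowerSeries.mk e) ≠ ⊤ := by
      refine ne_top_of_le_ne_top (qsum_one_series_ne_top f) ?_
      rw [qsum_series]
      exact wsum_mono fun k => by simpa using he k
    obtain ⟨g, hg⟩ := exists_series_eq h1
    exact ⟨g, fun k => by rw [← coeff_series, hg, PowerSeries.coeff_mk]⟩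
  obtain ⟨g, hg⟩ := key (fun k => if P k then f k else 0) fun k => by
    beta_reduce; split_ifs <;> simp
  obtain ⟨h, hh⟩ := key (fun k => if P k then 0 else f k) fun k => by
    beta_reduce; split_ifs <;> simp
  refine ⟨g, h, ?_, hg, hh⟩
  ext k
  rw [lp.coeFn_add, Pi.add_apply, hg, hh]
  split_ifs <;> simp

/-- The weight `min ((k+1)/(c+1)) ((c+1)/(k+1)) ^ s`, peaked at `c`. -/
def peakWeight (s c k : ℕ) : ℝ≥0 :=
  min ((((k : ℝ≥0) + 1) / (c + 1)) ^ s) ((((c : ℝ≥0) + 1) / (k + 1)) ^ s)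

theorem peakWeight_of_le {s c k : ℕ} (h : k ≤ c) :
    peakWeight s c k = (((k : ℝ≥0) + 1) / (c + 1)) ^ s := by
  have h1 : ((k : ℝ≥0) + 1) ≤ c + 1 := by gcongr
  refine min_eq_left (pow_le_pow_left' ?_ s)
  exact ((div_le_one₀ (by positivity)).2 h1).trans ((one_le_div₀ (by positivity)).2 h1)

theorem peakWeight_of_ge {s c k : ℕ} (h : c ≤ k) :
    peakWeight s c k = (((c : ℝ≥0) + 1) / (k + 1)) ^ s := by
  have h1 : ((c : ℝ≥0) + 1) ≤ k + 1 := by gcongr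
  refine min_eq_right (pow_le_pow_left' ?_ s)
  exact ((div_le_one₀ (by positivity)).2 h1).trans ((one_le_div₀ (by positivity)).2 h1)

theorem div_pow_eq_powWeight (s c k : ℕ) :
    (((k : ℝ≥0) + 1) / (c + 1)) ^ s = powWeight (-s) c * powWeight s k := by
  rw [powWeight_neg, powWeight, powWeight, zpow_natCast, zpow_natCast, div_pow, div_eq_inv_mul]

theorem div_pow_eq_powWeight' (s c k : ℕ) :
    (((c : ℝ≥0) + 1) / (k + 1)) ^ s = powWeight s c * powWeight (-s) k := by
  rw [div_pow_eq_powWeight, mul_comm]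

/-- The vector is cut where `ν₁` passes `c`. On the target the peaked weight is at most either of
its two branches; on each half of the source it equals the corresponding branch. The normalisation
in `c` is the same on both sides, so the constant does not depend on `c`. -/
theorem WBounded.exists_peakWeight_bound {T : H2 →ₗ[ℂ] H2} {ν₁ ν₂ : ℕ → ℕ} {s : ℕ}
    (hp : WBounded T (fun k => powWeight s (ν₁ k)) fun k => powWeight s (ν₂ k))
    (hm : WBounded T (fun k => powWeight (-s) (ν₁ k)) fun k => powWeight (-s) (ν₂ k)) :
    ∃ K : ℝ≥0, ∀ (c : ℕ) (f : H2), wsum (fun k => peakWeight s c (ν₂ k)) (T f) ≤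
      K * wsum (fun k => peakWeight s c (ν₁ k)) f := by
  obtain ⟨K, hK⟩ := hp
  obtain ⟨L, hL⟩ := hm
  refine ⟨2 * (K + L), fun c f => ?_⟩
  obtain ⟨g, h, rfl, hg, hh⟩ := exists_split f fun k => ν₁ k ≤ c
  have e1 : wsum (fun k => peakWeight s c (ν₂ k)) (T g) ≤
      K * wsum (fun k => peakWeight s c (ν₁ k)) (g + h : H2) := by
    calc wsum (fun k => peakWeight s c (ν₂ k)) (T g)
        ≤ powWeight (-s) c * wsum (fun k => powWeight s (ν₂ k)) (T g) :=
          wsum_le_of_weight_le (fun k => by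
            rw [← div_pow_eq_powWeight]; exact min_le_left _ _) _
      _ ≤ powWeight (-s) c * (K * wsum (fun k => powWeight s (ν₁ k)) g) := by gcongr; exact hK g
      _ = K * (powWeight (-s) c * wsum (fun k => powWeight s (ν₁ k)) g) := by ring
      _ ≤ _ := by
        gcongr
        rw [wsum, ← ENNReal.tsum_mul_left]
        refine ENNReal.tsum_le_tsum fun k => ?_
        beta_reduce
        rw [hg]
        split_ifs with hk
        · rw [peakWeight_of_le hk, div_pow_eq_powWeight, ENNReal.coe_mul, mul_assoc]
        · simp
  have e2 : wsum (fun k => peakWeight s c (ν₂ k)) (T h) ≤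
      L * wsum (fun k => peakWeight s c (ν₁ k)) (g + h : H2) := by
    calc wsum (fun k => peakWeight s c (ν₂ k)) (T h)
        ≤ powWeight s c * wsum (fun k => powWeight (-s) (ν₂ k)) (T h) :=
          wsum_le_of_weight_le (fun k => by
            rw [← div_pow_eq_powWeight']; exact min_le_right _ _) _
      _ ≤ powWeight s c * (L * wsum (fun k => powWeight (-s) (ν₁ k)) h) := by gcongr; exact hL h
      _ = L * (powWeight s c * wsum (fun k => powWeight (-s) (ν₁ k)) h) := by ring
      _ ≤ _ := by
        gcongr
        rw [wsum, ← ENNReal.tsum_mul_left]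
        refine ENNReal.tsum_le_tsum fun k => ?_
        beta_reduce
        rw [hh]
        split_ifs with hk
        · simp
        · rw [peakWeight_of_ge (not_le.1 hk).le, div_pow_eq_powWeight', ENNReal.coe_mul, mul_assoc]
  rw [map_add]
  refine (wsum_add_le _ _ _).trans ?_
  rw [ENNReal.coe_mul, ENNReal.coe_add, ENNReal.coe_ofNat, mul_assoc, add_mul]
  gcongr

/-- The weight `γ` changes at most polynomially: `γ_c / γ_k` and `γ_k / γ_c` are at most
`M ((c+1)/(k+1)) ^ L` for `k ≤ c`. -/
structure PolyRegular (γ : ℕ → ℝ≥0) (M : ℝ≥0) (L : ℕ) : Prop where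
  up : ∀ k c, k ≤ c → γ c ≤ M * (((c : ℝ≥0) + 1) / (k + 1)) ^ L * γ k
  down : ∀ k c, k ≤ c → γ k ≤ M * (((c : ℝ≥0) + 1) / (k + 1)) ^ L * γ c

/-- The superposition of peaked weights that is comparable with `γ`. -/
def peakSum (γ : ℕ → ℝ≥0) (s k : ℕ) : ℝ≥0∞ :=
  ∑' c : ℕ, ((γ c / (c + 1) * peakWeight s c k : ℝ≥0) : ℝ≥0∞)

/-- The terms with `c ≤ k` add up to `1`. The others are dominated by the telescoping terms
`(k+1)(1/c - 1/(c+1))`, whose sum is again `1`. -/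
theorem tsum_peak_le (k : ℕ) : ∑' c : ℕ, ((if c ≤ k then ((k : ℝ≥0) + 1)⁻¹ else
    ((k : ℝ≥0) + 1) / ((c : ℝ≥0) + 1) ^ 2 : ℝ≥0) : ℝ≥0∞) ≤ 2 := by
  have h : ∀ n : ℕ, ∑ c ∈ Finset.range n, (if c ≤ k then ((k : ℝ) + 1)⁻¹ else
      ((k : ℝ) + 1) / ((c : ℝ) + 1) ^ 2) ≤
      if n ≤ k + 1 then (n : ℝ) / (k + 1) else 2 - (k + 1) / n := by
    intro n
    induction n with
    | zero => simp
    | succ n ih =>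
      rw [Finset.sum_range_succ]
      rcases lt_trichotomy n (k + 1) with hn | hn | hn
      · rw [if_pos hn.le] at ih
        rw [if_pos (by omega), if_pos (by omega)]
        refine (add_le_add_left ih _).trans_eq ?_
        push_cast; field_simp
      · rw [if_pos hn.le] at ih
        rw [if_neg (by omega), if_neg (by omega)]
        refine (add_le_add_left ih _).trans ?_
        subst hn
        push_cast
        have : (0 : ℝ) ≤ k := by positivity
        rw [div_self (by positivity)]
        have e : (2 : ℝ) - (k + 1) / (k + 1 + 1) - (1 + (k + 1) / (k + 1 + 1) ^ 2) =
            1 / (k + 1 + 1) ^ 2 := by field_simp; ring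
        have : (0 : ℝ) ≤ 1 / (k + 1 + 1) ^ 2 := by positivity
        linarith
      · rw [if_neg (by omega)] at ih
        rw [if_neg (by omega), if_neg (by omega)]
        refine (add_le_add_left ih _).trans ?_
        have hn0 : (0 : ℝ) < n := by exact_mod_cast (by omega : 0 < n)
        push_cast
        have e : (2 : ℝ) - (k + 1) / (n + 1) - (2 - (k + 1) / n + (k + 1) / (n + 1) ^ 2) =
            (k + 1) / (n * (n + 1) ^ 2) := by field_simp; ring
        have : (0 : ℝ) ≤ (k + 1) / (n * (n + 1) ^ 2) := by positivity
        linarith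
  refine ENNReal.tsum_le_of_sum_range_le fun n => ?_
  rw [← ENNReal.ofNNReal_finsetSum]
  have h2 : (if n ≤ k + 1 then (n : ℝ) / (k + 1) else 2 - (k + 1) / n) ≤ 2 := by
    split_ifs with hn
    · rw [div_le_iff₀ (by positivity)]
      have : (n : ℝ) ≤ k + 1 := by exact_mod_cast hn
      have : (0 : ℝ) ≤ k := by positivity
      linarith
    · have : (0 : ℝ) ≤ (k + 1) / n := by positivity
      linarith
  have h3 := (h n).trans h2
  have : ∑ c ∈ Finset.range n, (if c ≤ k then ((k : ℝ≥0) + 1)⁻¹ else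
      ((k : ℝ≥0) + 1) / ((c : ℝ≥0) + 1) ^ 2) ≤ 2 := by
    rw [← NNReal.coe_le_coe]
    push_cast
    refine le_trans (le_of_eq (Finset.sum_congr rfl fun c _ => ?_)) h3
    split_ifs <;> simp
  exact_mod_cast this

/-- Replacing `γ c` by `γ k` costs the `L`-th power of the ratio of `c+1` and `k+1`, while the peak
decays with its `s`-th power. Since `s ≥ L + 1`, one power of decay survives, which suffices for
summation against `1/(c+1)`. -/
theorem peakSum_le {γ : ℕ → ℝ≥0} {M : ℝ≥0} {L s : ℕ} (h : PolyRegular γ M L) (hs : L + 1 ≤ s)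
    (k : ℕ) : peakSum γ s k ≤ ((2 * M * γ k : ℝ≥0) : ℝ≥0∞) := by
  have key : ∀ c : ℕ, γ c / (c + 1) * peakWeight s c k ≤ M * γ k *
      (if c ≤ k then ((k : ℝ≥0) + 1)⁻¹ else ((k : ℝ≥0) + 1) / ((c : ℝ≥0) + 1) ^ 2) := by
    intro c
    have aux : ∀ x y : ℝ≥0, 0 < x → x ≤ y → (y / x) ^ L * (x / y) ^ s ≤ x / y := by
      intro x y hx hxy
      have hy : 0 < y := hx.trans_le hxy
      obtain ⟨t, rfl⟩ := Nat.exists_eq_add_of_le hs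
      have h1 : (y / x) ^ L * (x / y) ^ (L + 1 + t) = (x / y) * (x / y) ^ t := by
        rw [pow_add, pow_add, ← mul_assoc, ← mul_assoc, ← mul_pow]
        have : y / x * (x / y) = 1 := by field_simp
        rw [this]; simp
      rw [h1]
      exact mul_le_of_le_one_right zero_le (pow_le_one₀ zero_le ((div_le_one₀ hy).2 hxy))
    split_ifs with hc
    · rw [peakWeight_of_ge hc]
      have h1 := h.down c k hc
      have h2 := aux (c + 1) (k + 1) (by positivity) (by gcongr)
      calc γ c / (c + 1) * (((c : ℝ≥0) + 1) / (k + 1)) ^ s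
          ≤ M * (((k : ℝ≥0) + 1) / (c + 1)) ^ L * γ k / (c + 1) *
            (((c : ℝ≥0) + 1) / (k + 1)) ^ s := by gcongr
        _ = M * γ k * (((((k : ℝ≥0) + 1) / (c + 1)) ^ L * (((c : ℝ≥0) + 1) / (k + 1)) ^ s)
            / (c + 1)) := by ring
        _ ≤ M * γ k * ((((c : ℝ≥0) + 1) / (k + 1)) / (c + 1)) := by gcongr
        _ = _ := by congr 1; field_simp
    · have hc' := (not_le.1 hc).le
      rw [peakWeight_of_le hc']
      have h1 := h.up k c hc'
      have h2 := aux (k + 1) (c + 1) (by positivity) (by gcongr)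
      calc γ c / (c + 1) * (((k : ℝ≥0) + 1) / (c + 1)) ^ s
          ≤ M * (((c : ℝ≥0) + 1) / (k + 1)) ^ L * γ k / (c + 1) *
            (((k : ℝ≥0) + 1) / (c + 1)) ^ s := by gcongr
        _ = M * γ k * (((((c : ℝ≥0) + 1) / (k + 1)) ^ L * (((k : ℝ≥0) + 1) / (c + 1)) ^ s)
            / (c + 1)) := by ring
        _ ≤ M * γ k * ((((k : ℝ≥0) + 1) / (c + 1)) / (c + 1)) := by gcongr
        _ = _ := by congr 1; field_simp
  calc peakSum γ s k ≤ ∑' c : ℕ, ((M * γ k : ℝ≥0) : ℝ≥0∞) *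
        ((if c ≤ k then ((k : ℝ≥0) + 1)⁻¹ else
          ((k : ℝ≥0) + 1) / ((c : ℝ≥0) + 1) ^ 2 : ℝ≥0) : ℝ≥0∞) :=
        ENNReal.tsum_le_tsum fun c => by exact_mod_cast key c
    _ ≤ ((M * γ k : ℝ≥0) : ℝ≥0∞) * 2 := by
        rw [ENNReal.tsum_mul_left]
        gcongr
        exact tsum_peak_le k
    _ = _ := by push_cast; ring

/-- The `k + 1` indices `c` from `k` to `2k` are enough: there `c + 1 ≤ 2(k + 1)`, so each term is
at least a fixed multiple of `γ k / (k + 1)`. -/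
theorem le_peakSum {γ : ℕ → ℝ≥0} {M : ℝ≥0} {L : ℕ} (s : ℕ) (h : PolyRegular γ M L) (k : ℕ) :
    (γ k : ℝ≥0∞) ≤ ((M * 2 ^ L * 2 ^ (s + 1) : ℝ≥0) : ℝ≥0∞) * peakSum γ s k := by
  have key : ∀ c ∈ Finset.Icc k (2 * k), γ k / (k + 1) ≤
      M * 2 ^ L * 2 ^ (s + 1) * (γ c / (c + 1) * peakWeight s c k) := by
    intro c hc
    obtain ⟨hc1, hc2⟩ := Finset.mem_Icc.1 hc
    have hc3 : ((c : ℝ≥0) + 1) ≤ 2 * (k + 1) := by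
      have : c + 1 ≤ 2 * (k + 1) := by omega
      exact_mod_cast this
    have h1 : ((c : ℝ≥0) + 1) / (k + 1) ≤ 2 := (div_le_iff₀ (by positivity)).2 hc3
    have h2 : 1 ≤ 2 * (((k : ℝ≥0) + 1) / (c + 1)) := by
      rw [← mul_div_assoc]; exact (one_le_div₀ (by positivity)).2 hc3
    have h2' := one_le_pow₀ h2 (n := s)
    rw [mul_pow] at h2'
    have h3 : ((k : ℝ≥0) + 1)⁻¹ ≤ 2 * ((c : ℝ≥0) + 1)⁻¹ := by
      rw [← div_eq_mul_inv, le_div_iff₀ (by positivity), inv_mul_le_iff₀ (by positivity)]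
      linarith
    rw [peakWeight_of_le hc1]
    calc γ k / (k + 1) = γ k * ((k : ℝ≥0) + 1)⁻¹ * 1 := by rw [mul_one, div_eq_mul_inv]
      _ ≤ (M * 2 ^ L * γ c) * (2 * ((c : ℝ≥0) + 1)⁻¹) *
          (2 ^ s * (((k : ℝ≥0) + 1) / (c + 1)) ^ s) := by
        gcongr
        refine (h.down k c hc1).trans ?_
        gcongr
      _ = _ := by rw [div_eq_mul_inv (γ c)]; ring
  calc (γ k : ℝ≥0∞) = ((∑ _c ∈ Finset.Icc k (2 * k), γ k / (k + 1) : ℝ≥0) : ℝ≥0∞) := by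
        rw [Finset.sum_const, Nat.card_Icc, nsmul_eq_mul]
        congr 1
        rw [show 2 * k + 1 - k = k + 1 by omega]
        push_cast
        field_simp
    _ ≤ ((∑ c ∈ Finset.Icc k (2 * k),
          M * 2 ^ L * 2 ^ (s + 1) * (γ c / (c + 1) * peakWeight s c k) : ℝ≥0) : ℝ≥0∞) := by
        exact_mod_cast Finset.sum_le_sum key
    _ = ((M * 2 ^ L * 2 ^ (s + 1) : ℝ≥0) : ℝ≥0∞) * ∑ c ∈ Finset.Icc k (2 * k),
          ((γ c / (c + 1) * peakWeight s c k : ℝ≥0) : ℝ≥0∞) := by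
        rw [← Finset.mul_sum, ENNReal.coe_mul, ENNReal.ofNNReal_finsetSum]
    _ ≤ _ := by
        gcongr
        exact ENNReal.sum_le_tsum _

/-- Interpolation: an operator bounded for `(k+1)^s` and `(k+1)^{-s}` is bounded for every
polynomially regular weight of order less than `s`. -/
theorem WBounded.interpolate {T : H2 →ₗ[ℂ] H2} {ν₁ ν₂ : ℕ → ℕ} {s : ℕ}
    (hp : WBounded T (fun k => powWeight s (ν₁ k)) fun k => powWeight s (ν₂ k))
    (hm : WBounded T (fun k => powWeight (-s) (ν₁ k)) fun k => powWeight (-s) (ν₂ k))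
    {γ : ℕ → ℝ≥0} {M : ℝ≥0} {L : ℕ} (h : PolyRegular γ M L) (hs : L + 1 ≤ s) :
    WBounded T (fun k => γ (ν₁ k)) fun k => γ (ν₂ k) := by
  obtain ⟨K, hK⟩ := WBounded.exists_peakWeight_bound hp hm
  -- Tonelli: the square sum for the superposed weight is the superposition of the square sums for
  -- the peaks.
  have swap : ∀ (ν : ℕ → ℕ) (f : H2), ∑' k, peakSum γ s (ν k) * ‖f k‖ₑ ^ 2 =
      ∑' c : ℕ, ((γ c / (c + 1) : ℝ≥0) : ℝ≥0∞) * wsum (fun k => peakWeight s c (ν k)) f := by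
    intro ν f
    simp_rw [peakSum, wsum, ← ENNReal.tsum_mul_right, ← ENNReal.tsum_mul_left]
    rw [ENNReal.tsum_comm]
    refine tsum_congr fun c => tsum_congr fun k => ?_
    rw [ENNReal.coe_mul, mul_assoc]
  set D : ℝ≥0 := M * 2 ^ L * 2 ^ (s + 1)
  refine ⟨D * K * (2 * M), fun f => ?_⟩
  calc wsum (fun k => γ (ν₂ k)) (T f)
      ≤ ∑' k, (D * peakSum γ s (ν₂ k)) * ‖T f k‖ₑ ^ 2 :=
        ENNReal.tsum_le_tsum fun k => by gcongr; exact le_peakSum s h _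
    _ = D * ∑' c : ℕ, ((γ c / (c + 1) : ℝ≥0) : ℝ≥0∞) *
          wsum (fun k => peakWeight s c (ν₂ k)) (T f) := by
        simp_rw [mul_assoc, ENNReal.tsum_mul_left, swap]
    _ ≤ D * ∑' c : ℕ, ((γ c / (c + 1) : ℝ≥0) : ℝ≥0∞) *
          (K * wsum (fun k => peakWeight s c (ν₁ k)) f) := by
        gcongr with c
        exact hK c f
    _ = D * K * ∑' k, peakSum γ s (ν₁ k) * ‖f k‖ₑ ^ 2 := by
        simp_rw [swap, mul_left_comm _ (K : ℝ≥0∞), ENNReal.tsum_mul_left, mul_assoc]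
    _ ≤ D * K * ∑' k, ((2 * M * γ (ν₁ k) : ℝ≥0) : ℝ≥0∞) * ‖f k‖ₑ ^ 2 := by
        gcongr with k
        exact peakSum_le h hs _
    _ = _ := by
        simp_rw [ENNReal.coe_mul, mul_assoc, ENNReal.tsum_mul_left]
        rfl

/-! ### Takenaka–Malmquist systems with periodic zeros -/

/-- The polynomial with coefficients `p_{mk+j}`. -/
def decimate (m j : ℕ) (p : Polynomial ℂ) : Polynomial ℂ :=
  ∑ k ∈ Finset.range (p.natDegree + 1), Polynomial.monomial k (p.coeff (m * k + j))

theorem coeff_decimate {m : ℕ} (hm : 0 < m) (j : ℕ) (p : Polynomial ℂ) (k : ℕ) :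
    (decimate m j p).coeff k = p.coeff (m * k + j) := by
  rw [decimate, Polynomial.finsetSum_coeff]
  simp only [Polynomial.coeff_monomial, Finset.sum_ite_eq', Finset.mem_range]
  split_ifs with h
  · rfl
  · refine (Polynomial.coeff_eq_zero_of_natDegree_lt ?_).symm
    have : k ≤ m * k := Nat.le_mul_of_pos_left k hm
    omega

theorem decimate_add {m : ℕ} (hm : 0 < m) (j : ℕ) (p q : Polynomial ℂ) :
    decimate m j (p + q) = decimate m j p + decimate m j q := by
  ext k
  simp only [coeff_decimate hm, Polynomial.coeff_add]

theorem decimate_monomial {m : ℕ} (hm : 0 < m) {j : ℕ} (hj : j < m) (n : ℕ) (x : ℂ) :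
    decimate m j (Polynomial.monomial n x) =
      if j = n % m then Polynomial.monomial (n / m) x else 0 := by
  ext k
  rw [coeff_decimate hm, Polynomial.coeff_monomial]
  by_cases h : n = m * k + j
  · have h1 : n % m = j := by rw [h, Nat.mul_add_mod, Nat.mod_eq_of_lt hj]
    have h2 : n / m = k := by
      rw [h, Nat.mul_add_div hm, Nat.div_eq_of_lt hj, add_zero]
    rw [if_pos h, if_pos h1.symm, Polynomial.coeff_monomial, if_pos h2]
  · rw [if_neg h]
    split_ifs with h1
    · rw [Polynomial.coeff_monomial, if_neg]
      rintro rfl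
      exact h (by rw [h1, Nat.div_add_mod])
    · simp

theorem qsum_decimate_le {m : ℕ} (hm : 0 < m) {j : ℕ} (hj : j < m) (v : ℕ → ℝ≥0)
    (p : Polynomial ℂ) :
    qsum v (decimate m j p : ℂ⟦X⟧) ≤ wsum (fun n => v (n / m)) (polyH p) := by
  rw [← qsum_series, series_polyH, qsum, qsum, wsum, wsum]
  have hinj : Function.Injective fun k => m * k + j := fun k l h => by
    have : m * k = m * l := by simpa using h
    exact Nat.eq_of_mul_eq_mul_left hm this
  refine le_trans (le_of_eq (tsum_congr fun k => ?_))
    (ENNReal.tsum_comp_le_tsum_of_injective hinj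
      fun n => (v (n / m) : ℝ≥0∞) * ‖coeff n (p : ℂ⟦X⟧)‖ₑ ^ 2)
  simp only [Polynomial.coeff_coe, coeff_decimate hm]
  rw [Nat.mul_add_div hm, Nat.div_eq_of_lt hj, add_zero]

section Periodic

variable {c : ℕ → ℂ} {a : ℕ → Complex.UnitDisc} {m : ℕ}

theorem malmquist_add_period (hcp : Function.Periodic c m) (hap : Function.Periodic a m) (n : ℕ) :
    malmquist c a (n + m) = mulH (partialProd c a m) (malmquist c a n) := by
  have e : partialProd c a (n + m) = partialProd c a m * partialProd c a n := by
    rw [partialProd, add_comm, Finset.prod_range_add]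
    congr 1
    exact Finset.prod_congr rfl fun i _ => by rw [add_comm m i, hcp, hap]
  rw [malmquist, malmquist, e, mulH_mul, hap]

theorem series_malmquist (hcp : Function.Periodic c m) (hap : Function.Periodic a m) (k j : ℕ) :
    series (malmquist c a (m * k + j)) =
      (partialProd c a m : ℂ⟦X⟧) ^ k * series (malmquist c a j) := by
  induction k with
  | zero => simp
  | succ k ih =>
    rw [show m * (k + 1) + j = m * k + j + m by ring, malmquist_add_period hcp hap, series_mulH, ih,
      pow_succ']
    ring

/-- By periodicity the basis vector of index `mk + j` is `B^k e_j`. Grouping the coefficients by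
residue modulo `m` leaves one composition with `B` for each `j`. -/
theorem series_malmquistUnitary_polyH (hm : 0 < m) (hc : ∀ i, ‖c i‖ = 1)
    (ha : ∀ n, ∃ i ≥ n, a i = 0) (hcp : Function.Periodic c m) (hap : Function.Periodic a m)
    (p : Polynomial ℂ) :
    series (malmquistUnitary hc ha (polyH p)) = ∑ j ∈ Finset.range m,
      series (malmquist c a j) *
        Polynomial.aeval (partialProd c a m : ℂ⟦X⟧) (decimate m j p) := by
  induction p using Polynomial.induction_on' with
  | add p q hp hq =>
    rw [polyH_add, map_add, map_add, hp, hq, ← Finset.sum_add_distrib]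
    refine Finset.sum_congr rfl fun j _ => ?_
    rw [decimate_add hm, map_add, mul_add]
  | monomial n x =>
    have hn : n % m < m := Nat.mod_lt n hm
    rw [polyH_monomial, map_smul, map_smul, malmquistUnitary_unitVec,
      Finset.sum_eq_single_of_mem (n % m) (Finset.mem_range.2 hn) fun j hj hne => by
        rw [decimate_monomial hm (Finset.mem_range.1 hj), if_neg hne, map_zero, mul_zero],
      decimate_monomial hm hn, if_pos rfl, Polynomial.aeval_monomial, ← Nat.div_add_mod n m,
      series_malmquist hcp hap, Nat.div_add_mod, PowerSeries.smul_eq_C_mul]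
    have : algebraMap ℂ ℂ⟦X⟧ x = C x := rfl
    rw [this]
    ring

theorem exists_partialProd_eq_X_mul (hm : 0 < m) (hc : ∀ i, ‖c i‖ = 1) (h0 : a 0 = 0) :
    ∃ ψ ∈ ratAlg, IsContractive ψ ∧ (partialProd c a m : ℂ⟦X⟧) = X * ψ := by
  obtain ⟨l, rfl⟩ := Nat.exists_eq_succ_of_ne_zero hm.ne'
  set g : ratAlg := ∏ i ∈ Finset.range l, factor (c (i + 1)) (a (i + 1)) with hg
  have hn : ‖-c 0‖ ≤ 1 := by rw [norm_neg, hc]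
  refine ⟨C (-c 0) * g, ratAlg.mul_mem (C_mem_ratAlg _) g.2,
    (isContractive_C hn).mul ?_, ?_⟩
  · rw [hg]
    push_cast
    exact isContractive_prod _ fun i _ =>
      (isContractive_C (hc _).le).mul (isContractive_mobius (a _).norm_lt_one)
  · rw [partialProd, Finset.prod_range_succ', ← hg]
    push_cast
    rw [coe_factor, h0, Complex.UnitDisc.coe_zero, mobius_zero, map_neg]
    ring

theorem polyBounded_malmquistUnitary (hm : 0 < m) (hc : ∀ i, ‖c i‖ = 1)
    (ha : ∀ n, ∃ i ≥ n, a i = 0) (hcp : Function.Periodic c m) (hap : Function.Periodic a m)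
    (h0 : a 0 = 0) (s : ℤ) :
    PolyBounded (malmquistUnitary hc ha).toLinearEquiv (fun n => powWeight (2 * s) (n / m))
      (powWeight (2 * s)) := by
  obtain ⟨ψ, hψ, hψc, hB⟩ := exists_partialProd_eq_X_mul hm hc h0
  obtain ⟨K, hK⟩ := compBounded_two_mul hψc hψ s
  have he : ∀ j, ∃ M : ℝ≥0, ∀ F, qsum (powWeight (2 * s)) (series (malmquist c a j) * F) ≤
      M * qsum (powWeight (2 * s)) F := fun j => by
    rw [malmquist, series_mulH, series_kernelH]
    exact isMultiplier_of_mem_ratAlg (admissible_powWeight _)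
      (ratAlg.mul_mem (partialProd c a j).2 (kernel_mem_ratAlg (a j).norm_lt_one))
  choose M hM using he
  obtain ⟨N, hN⟩ := wsum_sum_le (Finset.range m)
  refine ⟨N * ((∑ j ∈ Finset.range m, M j) * K), fun p => ?_⟩
  change wsum _ (malmquistUnitary hc ha (polyH p)) ≤ _
  rw [← qsum_series, series_malmquistUnitary_polyH hm hc ha hcp hap, hB]
  have h1 := hN (powWeight (2 * s)) fun j k =>
    coeff k (series (malmquist c a j) * Polynomial.aeval (X * ψ) (decimate m j p))
  refine le_trans (le_of_eq ?_) (h1.trans ?_)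
  · rw [qsum]
    congr 1
    funext k
    rw [map_sum, Finset.sum_apply]
  · rw [ENNReal.coe_mul, ENNReal.coe_mul, mul_assoc, mul_assoc, ENNReal.ofNNReal_finsetSum,
      Finset.sum_mul]
    gcongr with j hj
    refine (hM j _).trans ?_
    gcongr
    refine (hK _).trans ?_
    gcongr
    exact qsum_decimate_le hm (Finset.mem_range.1 hj) _ p

end Periodic

/-! ### The unitary operator attached to a Blaschke product -/

theorem powWeight_neg_eq_inv (s : ℤ) : powWeight (2 * -s) = (powWeight (2 * s))⁻¹ := by
  funext k
  rw [mul_neg, powWeight_neg, Pi.inv_apply]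

/-- Duality is used twice. The bound on polynomials for `-s` gives the full bound for the inverse at
`s`; dualising that one gives the full bound for `Ψ`. This needs the hypothesis for both signs of
`s`. -/
theorem wBounded_of_polyBounded {Ψ : H2 ≃ₗᵢ[ℂ] H2} {ν : ℕ → ℕ}
    (h : ∀ s : ℤ, PolyBounded Ψ.toLinearEquiv (fun n => powWeight (2 * s) (ν n))
      (powWeight (2 * s))) (s : ℤ) :
    WBounded Ψ.toLinearEquiv (fun n => powWeight (2 * s) (ν n)) (powWeight (2 * s)) ∧
      WBounded Ψ.symm.toLinearEquiv (powWeight (2 * s)) fun n => powWeight (2 * s) (ν n) := by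
  have h1 : ∀ s : ℤ, WBounded Ψ.symm.toLinearEquiv (powWeight (2 * s))
      fun n => powWeight (2 * s) (ν n) := fun s => by
    refine PolyBounded.symm (fun k => powWeight_pos _ _) (fun k => powWeight_pos _ _) ?_
    have := h (-s)
    rw [powWeight_neg_eq_inv] at this
    exact this
  refine ⟨?_, h1 s⟩
  refine PolyBounded.symm (Ψ := Ψ.symm) (fun k => powWeight_pos _ _)
    (fun k => powWeight_pos _ _) ?_
  have := (h1 (-s)).polyBounded
  rw [powWeight_neg_eq_inv] at this
  exact this

theorem wBounded_moebUnitary (a : Complex.UnitDisc) (s : ℤ) :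
    WBounded (moebUnitary a).toLinearEquiv (powWeight (2 * s)) (powWeight (2 * s)) :=
  (wBounded_of_polyBounded (ν := id) (polyBounded_moebUnitary a) s).1

theorem norm_one_sub_conj_mul_comm (a d : ℂ) : ‖1 - conj a * d‖ = ‖1 - conj d * a‖ := by
  rw [← RCLike.norm_conj (1 - conj a * d)]
  simp [mul_comm]

/-- For every Blaschke product there is a unitary operator that conjugates it to a power of the
shift and is bounded, with its inverse, for all even power weights. -/
theorem exists_unitary {m : ℕ} (hm : 0 < m) {c : ℕ → ℂ} (hc : ∀ i, ‖c i‖ = 1)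
    (d : ℕ → Complex.UnitDisc) :
    ∃ Φ : H2 ≃ₗᵢ[ℂ] H2,
      (∀ s : ℤ, WBounded Φ.toLinearEquiv (fun n => powWeight (2 * s) (n / m)) (powWeight (2 * s))) ∧
      (∀ s : ℤ, WBounded Φ.symm.toLinearEquiv (powWeight (2 * s))
        fun n => powWeight (2 * s) (n / m)) ∧
      ∀ n, Φ (unitVec (n + m)) = mulH (partialProd c d m) (Φ (unitVec n)) := by
  -- The zeros are moved by the automorphism at `d 0` and repeated with period `m`. The first one
  -- lands at the origin, which serves both subordination and completeness.
  set a : Complex.UnitDisc := d 0 with ha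
  set b : ℕ → Complex.UnitDisc := fun i => Complex.UnitDisc.mk (discInv a (d (i % m)))
    (norm_discInv_lt_one a.norm_lt_one (d (i % m)).norm_lt_one) with hb
  -- Chosen to cancel the unimodular constant of `series_moebIso_mobius_mul`.
  set e : ℕ → ℂ := fun i => -(c (i % m) * ((1 - conj (a : ℂ) * d (i % m)) /
    (1 - conj (d (i % m) : ℂ) * a))) with he
  have he1 : ∀ i, ‖e i‖ = 1 := fun i => by
    have h0 := one_sub_conj_mul_ne_zero (d (i % m)).norm_lt_one a.norm_lt_one
    simp only [he]
    rw [norm_neg, norm_mul, hc, norm_div, norm_one_sub_conj_mul_comm,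
      div_self (norm_ne_zero_iff.2 h0), one_mul]
  have hbp : Function.Periodic b m := fun i => by simp [hb]
  have hep : Function.Periodic e m := fun i => by simp [he]
  have hb0 : b 0 = 0 := by
    ext
    simp [hb, discInv, ha]
  have hbz : ∀ n, ∃ i ≥ n, b i = 0 := fun n => ⟨n * m, Nat.le_mul_of_pos_right n hm, by
    have : b (n * m) = b 0 := by simp [hb]
    rw [this, hb0]⟩
  have hΨ := wBounded_of_polyBounded (polyBounded_malmquistUnitary hm he1 hbz hep hbp hb0)
  have step : ∀ i < m, ∀ g, moebIso a (mulH (factor (e i) (b i)) g) =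
      mulH (factor (c i) (d i)) (moebIso a g) := by
    intro i hi g
    have hg : series (mulH (factor 1 (b i)) g) = mobius (b i) * series g := by
      rw [series_mulH, coe_factor, map_one, one_mul]
    have hfac : mulH (factor (e i) (b i)) g = e i • mulH (factor 1 (b i)) g :=
      series_injective <| by
        rw [map_smul, hg, series_mulH, coe_factor, mul_assoc, PowerSeries.smul_eq_C_mul]
    have hbi : ((b i : Complex.UnitDisc) : ℂ) = discInv a (d i) := by
      simp [hb, Nat.mod_eq_of_lt hi]
    refine series_injective ?_
    rw [hfac, map_smul, map_smul, series_moebIso_mobius_mul a (d i) hbi hg, series_mulH, coe_factor,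
      PowerSeries.smul_eq_C_mul, ← mul_assoc, ← map_mul, ← mul_assoc]
    congr 3
    have h0 := one_sub_conj_mul_ne_zero (d i).norm_lt_one a.norm_lt_one
    have h1 := one_sub_conj_mul_ne_zero a.norm_lt_one (d i).norm_lt_one
    simp only [he, Nat.mod_eq_of_lt hi]
    rw [neg_mul_neg, mul_assoc, div_mul_div_cancel₀ h0, div_self h1, mul_one]
  have prod : ∀ n ≤ m, ∀ g, moebIso a (mulH (partialProd e b n) g) =
      mulH (partialProd c d n) (moebIso a g) := by
    intro n
    induction n with
    | zero => intro _ g; exact series_injective (by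
        have : ∀ f, mulH 1 f = f := fun f => series_injective (by simp [series_mulH])
        simp [partialProd, this])
    | succ n ih =>
      intro hn g
      have e1 : ∀ (c : ℕ → ℂ) (a : ℕ → Complex.UnitDisc),
          partialProd c a (n + 1) = partialProd c a n * factor (c n) (a n) := fun c a => by
        rw [partialProd, partialProd, Finset.prod_range_succ]
      rw [e1, e1, mulH_mul, mulH_mul, ih (by omega), step n (by omega)]
  refine ⟨(malmquistUnitary he1 hbz).trans (moebUnitary a), fun s => ?_, fun s => ?_, fun n => ?_⟩
  · exact (hΨ s).1.trans (wBounded_moebUnitary a s)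
  · rw [LinearIsometryEquiv.symm_trans]
    exact (wBounded_moebUnitary a s).trans (hΨ s).2
  · simp only [LinearIsometryEquiv.trans_apply, moebUnitary_apply, malmquistUnitary_unitVec]
    rw [malmquist_add_period hep hbp, prod m le_rfl]

/-! ### Regularity of weights of polynomial growth -/

namespace WeightSeq

variable {W : WeightSeq}

theorem beta_succ (W : WeightSeq) (k : ℕ) : W.beta (k + 1) = W.beta k * W.w (k + 1) :=
  Finset.prod_Icc_succ_top (Nat.le_add_left 1 k) _

/-- The weight `β_k²`. -/
def sqWeight (W : WeightSeq) (k : ℕ) : ℝ≥0 := ⟨W.beta k ^ 2, sq_nonneg _⟩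

theorem coe_sqWeight (W : WeightSeq) (k : ℕ) : (W.sqWeight k : ℝ) = W.beta k ^ 2 := rfl

/-- Bernoulli's inequality gives `1 + K/(k+1) ≤ (1 + 1/(k+1))^K`. For the reciprocal, `w⁻¹ - 1 = w⁻¹
(1 - w)` and `w⁻¹` is bounded by some `D` because `w → 1`; hence `K` must exceed both `A` and `D *
A`. -/
theorem PolynomialGrowth.exists_ratio_le (hW : W.PolynomialGrowth) :
    ∃ K : ℕ, ∀ k, W.w (k + 1) ≤ (((k : ℝ) + 1 + 1) / (k + 1)) ^ K ∧
      (W.w (k + 1))⁻¹ ≤ (((k : ℝ) + 1 + 1) / (k + 1)) ^ K := by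
  obtain ⟨A, hA⟩ := hW
  have hinv : Filter.Tendsto (fun k => (W.w k)⁻¹) Filter.atTop (nhds 1) := by
    simpa using W.tendsto_one.inv₀ one_ne_zero
  obtain ⟨D, hD⟩ := hinv.bddAbove_range
  obtain ⟨K, hK⟩ := exists_nat_ge (max A (D * A))
  have hA' : ∀ k : ℕ, ((k : ℝ) + 1) * |W.w (k + 1) - 1| ≤ A := fun k => by
    refine le_trans ?_ (hA ⟨k + 1, Nat.le_add_left 1 k, rfl⟩)
    push_cast
    gcongr
    linarith
  have bern : ∀ (k : ℕ) (x : ℝ), ((k : ℝ) + 1) * x ≤ K → 1 + x ≤ (((k : ℝ) + 1 + 1) / (k + 1)) ^ K := by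
    intro k x hx
    have h0 : (0 : ℝ) < (k : ℝ) + 1 := by positivity
    have h1 := one_add_mul_le_pow (a := 1 / ((k : ℝ) + 1))
      (le_trans (by norm_num) (by positivity : (0 : ℝ) ≤ 1 / ((k : ℝ) + 1))) K
    have e : 1 + 1 / ((k : ℝ) + 1) = ((k : ℝ) + 1 + 1) / (k + 1) := by field_simp
    rw [e] at h1
    refine le_trans ?_ h1
    have : x ≤ K * (1 / ((k : ℝ) + 1)) := by
      rw [mul_one_div, le_div_iff₀ h0]; linarith
    linarith
  refine ⟨K, fun k => ⟨?_, ?_⟩⟩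
  · have := bern k (W.w (k + 1) - 1) (le_trans
      (mul_le_mul_of_nonneg_left (le_abs_self _) (by positivity))
      ((hA' k).trans ((le_max_left _ _).trans hK)))
    linarith
  · have hw := W.pos (k + 1) (Nat.le_add_left 1 k)
    have hD' : (W.w (k + 1))⁻¹ ≤ D := hD ⟨k + 1, rfl⟩
    have hA0 : 0 ≤ A := le_trans (by positivity) (hA' k)
    have h1 : ((k : ℝ) + 1) * ((W.w (k + 1))⁻¹ - 1) ≤ K := by
      refine le_trans ?_ ((le_max_right _ _).trans hK)
      have e : (W.w (k + 1))⁻¹ - 1 = (W.w (k + 1))⁻¹ * -(W.w (k + 1) - 1) := by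
        field_simp; ring
      calc ((k : ℝ) + 1) * ((W.w (k + 1))⁻¹ - 1)
          = (W.w (k + 1))⁻¹ * (((k : ℝ) + 1) * -(W.w (k + 1) - 1)) := by rw [e]; ring
        _ ≤ (W.w (k + 1))⁻¹ * (((k : ℝ) + 1) * |W.w (k + 1) - 1|) := by
          gcongr; exact neg_le_abs _
        _ ≤ D * A := mul_le_mul hD' (hA' k) (by positivity) ((inv_pos.2 hw).le.trans hD')
    have := bern k _ h1
    linarith

theorem PolynomialGrowth.exists_polyRegular (hW : W.PolynomialGrowth) :
    ∃ L, PolyRegular W.sqWeight 1 L := by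
  obtain ⟨K, hK⟩ := hW.exists_ratio_le
  have h1 : ∀ k c : ℕ, k ≤ c → W.beta c ≤ (((c : ℝ) + 1) / (k + 1)) ^ K * W.beta k ∧
      W.beta k ≤ (((c : ℝ) + 1) / (k + 1)) ^ K * W.beta c := by
    intro k c hkc
    induction c, hkc using Nat.le_induction with
    | base =>
      have : ((k : ℝ) + 1) / (k + 1) = 1 := div_self (by positivity)
      simp [this]
    | succ c hkc ih =>
      have hw := W.pos (c + 1) (Nat.le_add_left 1 c)
      have hb := W.beta_pos c
      have hbk := W.beta_pos k
      have e : ((((c + 1 : ℕ) : ℝ) + 1) / (k + 1)) ^ K =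
          (((c : ℝ) + 1) / (k + 1)) ^ K * (((c : ℝ) + 1 + 1) / (c + 1)) ^ K := by
        rw [← mul_pow]
        congr 1
        push_cast
        field_simp
      rw [e]
      constructor
      · calc W.beta (c + 1) = W.beta c * W.w (c + 1) := W.beta_succ c
          _ ≤ (((c : ℝ) + 1) / (k + 1)) ^ K * W.beta k * (((c : ℝ) + 1 + 1) / (c + 1)) ^ K := by
            gcongr
            exacts [ih.1, (hK c).1]
          _ = _ := by ring
      · calc W.beta k ≤ (((c : ℝ) + 1) / (k + 1)) ^ K * W.beta c := ih.2
          _ = (((c : ℝ) + 1) / (k + 1)) ^ K * ((W.w (c + 1))⁻¹ * W.beta (c + 1)) := by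
            rw [beta_succ]; field_simp
          _ ≤ (((c : ℝ) + 1) / (k + 1)) ^ K *
              ((((c : ℝ) + 1 + 1) / (c + 1)) ^ K * W.beta (c + 1)) := by
            have := W.beta_pos (c + 1)
            gcongr
            exact (hK c).2
          _ = _ := by ring
  refine ⟨2 * K, fun k c h => ?_, fun k c h => ?_⟩
  · rw [← NNReal.coe_le_coe]
    push_cast
    rw [coe_sqWeight, coe_sqWeight, one_mul, mul_comm 2 K, pow_mul, ← mul_pow]
    exact pow_le_pow_left₀ (W.beta_pos c).le (h1 k c h).1 2
  · rw [← NNReal.coe_le_coe]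
    push_cast
    rw [coe_sqWeight, coe_sqWeight, one_mul, mul_comm 2 K, pow_mul, ← mul_pow]
    exact pow_le_pow_left₀ (W.beta_pos k).le (h1 k c h).2 2

end WeightSeq

theorem PolyRegular.admissible {γ : ℕ → ℝ≥0} {M : ℝ≥0} {L : ℕ} (h : PolyRegular γ M L) :
    Admissible γ := by
  refine ⟨M, L, fun k i => (h.up k (k + i) (Nat.le_add_right k i)).trans ?_⟩
  gcongr
  rw [div_le_iff₀ (by positivity)]
  push_cast
  calc (k : ℝ≥0) + i + 1 ≤ (k + i + 1) + i * k := le_add_right le_rfl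
    _ = _ := by ring

/-! ### Weighted Hardy spaces as sequence spaces -/

theorem HasTaylor.summable_norm {f : Complex.UnitDisc → ℂ} {c : ℕ → ℂ} (h : HasTaylor f c)
    (z : Complex.UnitDisc) : Summable fun k : ℕ => ‖c k * (z : ℂ) ^ k‖ :=
  summable_norm_iff.2 (h z).summable

theorem HasTaylor.mul {f g : Complex.UnitDisc → ℂ} {F G : ℂ⟦X⟧}
    (hf : HasTaylor f fun k => coeff k F) (hg : HasTaylor g fun k => coeff k G) :
    HasTaylor (fun z => f z * g z) fun k => coeff k (F * G) := fun z => by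
  have h1 := (summable_norm_sum_mul_antidiagonal_of_summable_norm (hf.summable_norm z)
    (hg.summable_norm z)).of_norm.hasSum
  rw [← tsum_mul_tsum_eq_tsum_sum_antidiagonal_of_summable_norm (hf.summable_norm z)
    (hg.summable_norm z), (hf z).tsum_eq, (hg z).tsum_eq] at h1
  convert! h1 using 2 with k
  beta_reduce
  rw [PowerSeries.coeff_mul, Finset.sum_mul]
  refine Finset.sum_congr rfl fun p hp => ?_
  rw [← Finset.HasAntidiagonal.mem_antidiagonal.1 hp, pow_add]
  ring

theorem hasTaylor_C (c : ℂ) : HasTaylor (fun _ => c) fun k => coeff k (C c) := fun z => by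
  have := hasSum_single (f := fun k : ℕ => coeff k (C c) * (z : ℂ) ^ k) 0 fun k hk => by
    simp [PowerSeries.coeff_C, hk]
  simpa using this

theorem hasTaylor_X : HasTaylor (fun z => (z : ℂ)) fun k => coeff k X := fun z => by
  have := hasSum_single (f := fun k : ℕ => coeff k (X : ℂ⟦X⟧) * (z : ℂ) ^ k) 1 fun k hk => by
    simp [PowerSeries.coeff_X, hk]
  simpa using this

theorem hasTaylor_geom {a : ℂ} (ha : ‖a‖ < 1) :
    HasTaylor (fun z => (1 - a * z)⁻¹) fun k => coeff k (geom a) := fun z => by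
  have h : ‖a * z‖ < 1 := by
    rw [norm_mul]
    nlinarith [norm_nonneg a, norm_nonneg (z : ℂ), z.norm_lt_one]
  simpa [geom, mul_pow] using hasSum_geometric_of_norm_lt_one h

theorem HasTaylor.sub {f g : Complex.UnitDisc → ℂ} {F G : ℂ⟦X⟧}
    (hf : HasTaylor f fun k => coeff k F) (hg : HasTaylor g fun k => coeff k G) :
    HasTaylor (fun z => f z - g z) fun k => coeff k (F - G) := fun z => by
  simpa [sub_mul] using (hf z).sub (hg z)

theorem hasTaylor_factor (c : ℂ) (a : Complex.UnitDisc) :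
    HasTaylor (fun z => c * (((a : ℂ) - z) / (1 - conj (a : ℂ) * z)))
      fun k => coeff k (factor c a : ℂ⟦X⟧) := by
  have h := (hasTaylor_C c).mul (((hasTaylor_C (a : ℂ)).sub hasTaylor_X).mul
    (hasTaylor_geom (a := conj (a : ℂ)) (by rw [RCLike.norm_conj]; exact a.norm_lt_one)))
  simpa only [div_eq_mul_inv] using! h

theorem hasTaylor_partialProd (c : ℕ → ℂ) (a : ℕ → Complex.UnitDisc) (n : ℕ) :
    HasTaylor (fun z => ∏ i ∈ Finset.range n,
      (c i * (((a i : ℂ) - z) / (1 - conj (a i : ℂ) * z))))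
      fun k => coeff k (partialProd c a n : ℂ⟦X⟧) := by
  induction n with
  | zero => simpa [partialProd] using hasTaylor_C 1
  | succ n ih =>
    simp only [partialProd, Finset.prod_range_succ] at ih ⊢
    exact ih.mul (hasTaylor_factor _ _)

namespace Hardy

variable {W : WeightSeq}

theorem ext_coeff {f g : Hardy W} (h : ∀ k, Hardy.coeff f k = Hardy.coeff g k) : f = g := by
  refine Subtype.ext (funext fun z => ?_)
  have h1 := hasTaylor f z
  rw [funext h] at h1
  exact h1.unique (hasTaylor g z)

theorem wsum_coeff (f : Hardy W) : wsum W.sqWeight (Hardy.coeff f) = ‖f‖ₑ ^ 2 := by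
  rw [enorm_sq_eq_ofReal, norm_sq_eq,
    ENNReal.ofReal_tsum_of_nonneg (fun k => by positivity) (summable_coeff f)]
  refine tsum_congr fun k => ?_
  rw [ENNReal.ofReal_mul (sq_nonneg _), enorm_sq_eq_ofReal, ← W.coe_sqWeight,
    ENNReal.ofReal_coe_nnreal]

/-- Regularity compared with `β_0 = 1` bounds `β_k⁻²` by a power of `k + 1`. The coefficients then
grow at most polynomially and the series converges in the whole disc. -/
theorem exists_coeff_eq (hW : W.PolynomialGrowth) {c : ℕ → ℂ} (h : wsum W.sqWeight c ≠ ⊤) :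
    ∃ f : Hardy W, Hardy.coeff f = c := by
  have hs := summable_of_wsum_ne_top h
  simp only [W.coe_sqWeight] at hs
  obtain ⟨L, hL⟩ := hW.exists_polyRegular
  have hT : HasTaylor (fun z => ∑' k, c k * (z : ℂ) ^ k) c := fun z => by
    refine Summable.hasSum ?_
    set S := ∑' k, W.beta k ^ 2 * ‖c k‖ ^ 2 with hS
    have hb : ∀ k : ℕ, ‖c k‖ ≤ (S + 1) * ((k : ℝ) + 1) ^ L := by
      intro k
      have h1 : W.beta k ^ 2 * ‖c k‖ ^ 2 ≤ S := hs.le_tsum k fun j _ => by positivity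
      have h2 := hL.down 0 k (Nat.zero_le k)
      rw [← NNReal.coe_le_coe] at h2
      push_cast at h2
      rw [W.coe_sqWeight, W.coe_sqWeight] at h2
      simp only [WeightSeq.beta, Finset.Icc_eq_empty_of_lt,
        Finset.prod_empty, one_pow, one_mul, zero_add, div_one, zero_lt_one] at h2
      have h3 : ‖c k‖ ^ 2 ≤ ((k : ℝ) + 1) ^ L * S := by
        calc ‖c k‖ ^ 2 ≤ ((k : ℝ) + 1) ^ L * W.beta k ^ 2 * ‖c k‖ ^ 2 :=
              le_mul_of_one_le_left (sq_nonneg _) h2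
          _ = ((k : ℝ) + 1) ^ L * (W.beta k ^ 2 * ‖c k‖ ^ 2) := by ring
          _ ≤ _ := by gcongr
      have hx : (1 : ℝ) ≤ ((k : ℝ) + 1) ^ L := one_le_pow₀ (by linarith [k.cast_nonneg (α := ℝ)])
      have hS0 : 0 ≤ S := tsum_nonneg fun k => by positivity
      refine le_of_sq_le_sq ?_ (by positivity)
      nlinarith [mul_nonneg hS0 (zero_le_one.trans hx), mul_nonneg (mul_nonneg hS0 hS0) (sq_nonneg (((k : ℝ) + 1) ^ L))]
    refine Summable.of_norm_bounded
      ((summable_geometric_mul_pow (norm_nonneg (z : ℂ)) z.norm_lt_one L).mul_left (S + 1))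
      fun k => ?_
    rw [norm_mul, norm_pow]
    calc ‖c k‖ * ‖(z : ℂ)‖ ^ k ≤ (S + 1) * ((k : ℝ) + 1) ^ L * ‖(z : ℂ)‖ ^ k := by
          gcongr; exact hb k
      _ = _ := by ring
  exact ⟨(⟨_, c, hT, hs⟩ : hardySubmodule W), coeff_eq hT⟩

/-- The power series of a function in the weighted Hardy space. -/
def toSeries (f : Hardy W) : ℂ⟦X⟧ := PowerSeries.mk (Hardy.coeff f)

@[simp] theorem coeff_toSeries (f : Hardy W) (k : ℕ) :
    PowerSeries.coeff k (toSeries f) = Hardy.coeff f k :=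
  PowerSeries.coeff_mk _ _

theorem qsum_toSeries (f : Hardy W) : qsum W.sqWeight (toSeries f) = ‖f‖ₑ ^ 2 := by
  simp only [qsum, coeff_toSeries]
  exact wsum_coeff f

/-- The function with Taylor coefficients `c` (zero if it is not in the space). -/
def ofCoeff (W : WeightSeq) (c : ℕ → ℂ) : Hardy W :=
  open scoped Classical in if h : ∃ f : Hardy W, Hardy.coeff f = c then h.choose else 0

theorem coeff_ofCoeff (hW : W.PolynomialGrowth) {c : ℕ → ℂ} (h : wsum W.sqWeight c ≠ ⊤) :
    Hardy.coeff (ofCoeff W c) = c := by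
  have h1 := exists_coeff_eq hW h
  rw [ofCoeff, dif_pos h1]
  exact h1.choose_spec

end Hardy

/-! ### Multiplication operators on `H²_β` -/

theorem norm_le_of_enorm_sq_le {E F : Type*} [NormedAddCommGroup E] [NormedAddCommGroup F] {x : E}
    {y : F} {K : ℝ≥0} (h : ‖y‖ₑ ^ 2 ≤ K * ‖x‖ₑ ^ 2) : ‖y‖ ≤ (NNReal.sqrt K : ℝ) * ‖x‖ := by
  simp only [enorm_eq_nnnorm] at h
  norm_cast at h
  have h2 : ‖y‖₊ ≤ NNReal.sqrt K * ‖x‖₊ := by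
    rw [← NNReal.sqrt_sq ‖x‖₊, ← NNReal.sqrt_mul]
    exact NNReal.le_sqrt_iff_sq_le.2 h
  exact NNReal.coe_le_coe.2 h2

theorem Hardy.exists_mulOp {W : WeightSeq} (hW : W.PolynomialGrowth) (g : ratAlg) :
    ∃ T : Hardy W →L[ℂ] Hardy W, ∀ f, Hardy.toSeries (T f) = g * Hardy.toSeries f := by
  obtain ⟨L, hL⟩ := hW.exists_polyRegular
  obtain ⟨K, hK⟩ := isMultiplier_of_mem_ratAlg hL.admissible g.2
  have key : ∀ f : Hardy W, ∃ h : Hardy W, Hardy.toSeries h = g * Hardy.toSeries f := by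
    intro f
    have h1 : qsum W.sqWeight (g * Hardy.toSeries f) ≠ ⊤ := by
      refine ne_top_of_le_ne_top (ENNReal.mul_ne_top ENNReal.coe_ne_top ?_) (hK _)
      rw [Hardy.qsum_toSeries]
      exact ENNReal.pow_ne_top enorm_ne_top
    obtain ⟨h, hh⟩ := Hardy.exists_coeff_eq hW h1
    exact ⟨h, by ext k; rw [Hardy.coeff_toSeries, hh]⟩
  choose T hT using key
  have inj : ∀ {f h : Hardy W}, Hardy.toSeries f = Hardy.toSeries h → f = h := fun {f h} e =>
    Hardy.ext_coeff fun k => by rw [← Hardy.coeff_toSeries, e, Hardy.coeff_toSeries]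
  have hadd : ∀ f h : Hardy W, Hardy.toSeries (f + h) = Hardy.toSeries f + Hardy.toSeries h :=
    fun f h => by ext k; simp [Hardy.coeff_add]
  have hsmul : ∀ (c : ℂ) (f : Hardy W), Hardy.toSeries (c • f) = c • Hardy.toSeries f :=
    fun c f => by ext k; simp [Hardy.coeff_smul]
  let T' : Hardy W →ₗ[ℂ] Hardy W :=
    { toFun := T
      map_add' := fun f h => inj (by rw [hT, hadd, hadd, hT, hT, mul_add])
      map_smul' := fun c f => inj (by
        rw [hT, hsmul, RingHom.id_apply, hsmul, hT, mul_smul_comm]) }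
  refine ⟨T'.mkContinuous (NNReal.sqrt K) fun f => norm_le_of_enorm_sq_le ?_, hT⟩
  change ‖T f‖ₑ ^ 2 ≤ _
  rw [← Hardy.qsum_toSeries, ← Hardy.qsum_toSeries, hT]
  exact hK _

theorem isMulOp_of_toSeries {W : WeightSeq} {g : ℂ⟦X⟧} {φ : Complex.UnitDisc → ℂ}
    (hφ : HasTaylor φ fun k => coeff k g) {T : Hardy W →L[ℂ] Hardy W}
    (hT : ∀ f, Hardy.toSeries (T f) = g * Hardy.toSeries f) : IsMulOp φ T := by
  intro f z
  have h1 : HasTaylor f fun k => coeff k (Hardy.toSeries f) := by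
    simpa using Hardy.hasTaylor f
  have h2 := hφ.mul h1 z
  rw [← hT] at h2
  simp only [Hardy.coeff_toSeries] at h2
  exact (Hardy.hasTaylor (T f) z).unique h2

/-! ### The isometry of `H²_β` with `ℓ²` -/

namespace Hardy

variable {W : WeightSeq}

theorem norm_beta_mul_coeff_sq (f : Hardy W) (k : ℕ) :
    ‖(W.beta k : ℂ) * Hardy.coeff f k‖ ^ 2 = W.beta k ^ 2 * ‖Hardy.coeff f k‖ ^ 2 := by
  rw [norm_mul, Complex.norm_real, Real.norm_of_nonneg (W.beta_pos k).le, mul_pow]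

theorem memℓp_coeff (f : Hardy W) : Memℓp (fun k => (W.beta k : ℂ) * Hardy.coeff f k) 2 :=
  memℓp_gen <| (summable_coeff f).congr fun k => by
    rw [← norm_beta_mul_coeff_sq]
    norm_num

/-- The isometry `f ↦ (β_k f̂(k))_k` of the weighted Hardy space into `ℓ²`. -/
def toH2 (W : WeightSeq) : Hardy W →ₗᵢ[ℂ] H2 where
  toFun f := ⟨fun k => (W.beta k : ℂ) * Hardy.coeff f k, memℓp_coeff f⟩
  map_add' f g := by
    ext k
    change (W.beta k : ℂ) * Hardy.coeff (f + g) k =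
      W.beta k * Hardy.coeff f k + W.beta k * Hardy.coeff g k
    rw [coeff_add, Pi.add_apply, mul_add]
  map_smul' c f := by
    ext k
    simp [coeff_smul]
    ring
  norm_map' f := by
    refine (pow_left_inj₀ (norm_nonneg _) (norm_nonneg _) two_ne_zero).1 ?_
    have h := lp.hasSum_norm (p := 2) (by norm_num) (⟨_, memℓp_coeff f⟩ : H2)
    norm_num at h
    refine h.tsum_eq.symm.trans ((tsum_congr fun k => ?_).trans (norm_sq_eq f).symm)
    rw [mul_pow, sq_abs]

theorem toH2_apply (f : Hardy W) (k : ℕ) : toH2 W f k = W.beta k * Hardy.coeff f k := rfl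

theorem toH2_surjective (hW : W.PolynomialGrowth) : Function.Surjective (toH2 W) := by
  intro g
  have hb : ∀ k, (W.beta k : ℂ) ≠ 0 := fun k => by exact_mod_cast (W.beta_pos k).ne'
  have h : wsum W.sqWeight (fun k => (W.beta k : ℂ)⁻¹ * g k) ≠ ⊤ := by
    have e : wsum W.sqWeight (fun k => (W.beta k : ℂ)⁻¹ * g k) = wsum 1 g := by
      refine tsum_congr fun k => ?_
      rw [enorm_sq_eq_ofReal, enorm_sq_eq_ofReal, ← ENNReal.ofReal_coe_nnreal,
        ← ENNReal.ofReal_mul (by positivity), W.coe_sqWeight, norm_mul, norm_inv,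
        Complex.norm_real, Real.norm_of_nonneg (W.beta_pos k).le]
      have := (W.beta_pos k).ne'
      simp only [Pi.one_apply, ENNReal.coe_one, one_mul]
      congr 1
      field_simp
    rw [e, wsum_one_eq]
    exact ENNReal.pow_ne_top enorm_ne_top
  obtain ⟨f, hf⟩ := exists_coeff_eq hW h
  refine ⟨f, ?_⟩
  ext k
  rw [toH2_apply, hf, mul_inv_cancel_left₀ (hb k)]

/-- The isometric isomorphism `f ↦ (β_k f̂(k))_k` onto `ℓ²`. -/
def equivH2 (hW : W.PolynomialGrowth) : Hardy W ≃ₗᵢ[ℂ] H2 :=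
  LinearIsometryEquiv.ofSurjective (toH2 W) (toH2_surjective hW)

theorem completeSpace (hW : W.PolynomialGrowth) : CompleteSpace (Hardy W) :=
  (equivH2 hW).toIsometryEquiv.completeSpace

/-- A closed subspace that contains the monomials is the whole space. -/
theorem mem_of_isClosed (hW : W.PolynomialGrowth) {R : Submodule ℂ (Hardy W)}
    (hR : IsClosed (R : Set (Hardy W)))
    (h : ∀ (k : ℕ) (f : Hardy W), (∀ l, l ≠ k → Hardy.coeff f l = 0) → f ∈ R) (f : Hardy W) :
    f ∈ R := by
  have h1 := (H2.hasSum_unitVec (equivH2 hW f)).mapL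
    ((equivH2 hW).symm.toContinuousLinearEquiv : H2 →L[ℂ] Hardy W)
  simp only [map_smul, ContinuousLinearEquiv.coe_coe,
    LinearIsometryEquiv.coe_toContinuousLinearEquiv, LinearIsometryEquiv.symm_apply_apply] at h1
  refine hR.mem_of_tendsto h1 (Filter.Eventually.of_forall fun s => ?_)
  refine R.sum_mem fun k _ => R.smul_mem _ (h k _ fun l hl => ?_)
  have h2 : toH2 W ((equivH2 hW).symm (unitVec k)) = unitVec k :=
    (equivH2 hW).apply_symm_apply _
  have h3 : toH2 W ((equivH2 hW).symm (unitVec k)) l = unitVec k l := by rw [h2]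
  rw [toH2_apply, unitVec, lp.single_apply_ne _ _ _ hl] at h3
  exact (mul_eq_zero.1 h3).resolve_left (Complex.ofReal_ne_zero.2 (W.beta_pos l).ne')

end Hardy

/-! ### Extension to the weighted spaces -/

/-- The elements of `ℓ²` with finite weighted square sum. -/
def domain (u : ℕ → ℝ≥0) : Submodule ℂ H2 where
  carrier := {f | wsum u f ≠ ⊤}
  zero_mem' := by
    change wsum u (0 : ℕ → ℂ) ≠ ⊤
    simp [wsum_zero]
  add_mem' {f g} hf hg := ne_top_of_le_ne_top
    (ENNReal.mul_ne_top ENNReal.ofNat_ne_top (ENNReal.add_ne_top.2 ⟨hf, hg⟩)) (wsum_add_le u f g)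
  smul_mem' c f hf := by
    change wsum u (c • (f : ℕ → ℂ)) ≠ ⊤
    rw [wsum_smul]
    exact ENNReal.mul_ne_top (ENNReal.pow_ne_top enorm_ne_top) hf

theorem WBounded.mem_domain {T : H2 →ₗ[ℂ] H2} {u v : ℕ → ℝ≥0} (h : WBounded T u v) {f : H2}
    (hf : f ∈ domain u) : T f ∈ domain v := by
  obtain ⟨K, hK⟩ := h
  exact ne_top_of_le_ne_top (ENNReal.mul_ne_top ENNReal.coe_ne_top hf) (hK f)

/-- A unitary operator bounded in both directions restricts to the weighted domains. -/
def domainEquiv {Φ : H2 ≃ₗᵢ[ℂ] H2} {u v : ℕ → ℝ≥0} (h : WBounded Φ.toLinearEquiv u v)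
    (h' : WBounded Φ.symm.toLinearEquiv v u) : domain u ≃ₗ[ℂ] domain v where
  toFun f := ⟨Φ f, h.mem_domain f.2⟩
  invFun f := ⟨Φ.symm f, h'.mem_domain f.2⟩
  map_add' _ _ := Subtype.ext (map_add Φ _ _)
  map_smul' _ _ := Subtype.ext (map_smul Φ _ _)
  left_inv _ := Subtype.ext (Φ.symm_apply_apply _)
  right_inv _ := Subtype.ext (Φ.apply_symm_apply _)

section Embeddings

variable {W : WeightSeq} (hW : W.PolynomialGrowth)

/-- The inclusion of the domain into the weighted Hardy space. -/
def toHardy : domain W.sqWeight →ₗ[ℂ] Hardy W where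
  toFun f := Hardy.ofCoeff W f.1
  map_add' f g := Hardy.ext_coeff fun k => by
    rw [Hardy.coeff_add, Hardy.coeff_ofCoeff hW f.2, Hardy.coeff_ofCoeff hW g.2,
      Hardy.coeff_ofCoeff hW (f + g).2]
    rfl
  map_smul' c f := Hardy.ext_coeff fun k => by
    rw [RingHom.id_apply, Hardy.coeff_smul, Hardy.coeff_ofCoeff hW f.2,
      Hardy.coeff_ofCoeff hW (c • f).2]
    rfl

theorem coeff_toHardy (f : domain W.sqWeight) : Hardy.coeff (toHardy hW f) = f.1 :=
  Hardy.coeff_ofCoeff hW f.2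

theorem enorm_toHardy_sq (f : domain W.sqWeight) :
    ‖toHardy hW f‖ₑ ^ 2 = wsum W.sqWeight f.1 := by
  rw [← Hardy.wsum_coeff, coeff_toHardy]

variable (m : ℕ) [NeZero m]

/-- Euclidean division `n = km + j` identifies the weight `γ (n / m)` with `m` orthogonal copies of
`γ`. -/
theorem wsum_interleave (γ : ℕ → ℝ≥0) (f : ℕ → ℂ) :
    wsum (fun n => γ (n / m)) f = ∑ j : Fin m, wsum γ fun k => f (k * m + j) := by
  rw [wsum, ← (Nat.divModEquiv m).symm.tsum_eq, ENNReal.tsum_prod', ENNReal.tsum_comm, tsum_fintype]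
  refine Finset.sum_congr rfl fun j _ => tsum_congr fun k => ?_
  have : (k * m + j) / m = k := by
    rw [Nat.mul_comm, Nat.mul_add_div (NeZero.pos m), Nat.div_eq_of_lt j.2, add_zero]
  simp [Nat.divModEquiv, this]

theorem wsum_interleave_ne_top {γ : ℕ → ℝ≥0} {f : ℕ → ℂ}
    (h : wsum (fun n => γ (n / m)) f ≠ ⊤) (j : Fin m) : wsum γ (fun k => f (k * m + j)) ≠ ⊤ := by
  rw [wsum_interleave] at h
  exact ENNReal.sum_ne_top.1 h j (Finset.mem_univ j)

/-- The map sending `f` to the tuple of functions with coefficients `f_{km+j}`. -/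
def toHardySum : domain (fun n => W.sqWeight (n / m)) →ₗ[ℂ] PiLp 2 (fun _ : Fin m => Hardy W) where
  toFun f := WithLp.toLp 2 fun j => Hardy.ofCoeff W fun k => f.1 (k * m + j)
  map_add' f g := by
    ext1 j
    refine Hardy.ext_coeff fun k => ?_
    rw [PiLp.add_apply, Hardy.coeff_add]
    simp only [Hardy.coeff_ofCoeff hW (wsum_interleave_ne_top m f.2 j),
      Hardy.coeff_ofCoeff hW (wsum_interleave_ne_top m g.2 j),
      Hardy.coeff_ofCoeff hW (wsum_interleave_ne_top m (f + g).2 j)]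
    rfl
  map_smul' c f := by
    ext1 j
    refine Hardy.ext_coeff fun k => ?_
    rw [RingHom.id_apply, PiLp.smul_apply, Hardy.coeff_smul]
    simp only [Hardy.coeff_ofCoeff hW (wsum_interleave_ne_top m f.2 j),
      Hardy.coeff_ofCoeff hW (wsum_interleave_ne_top m (c • f).2 j)]
    rfl

theorem coeff_toHardySum (f : domain fun n => W.sqWeight (n / m)) (j : Fin m) :
    Hardy.coeff (toHardySum hW m f j) = fun k => f.1 (k * m + j) :=
  Hardy.coeff_ofCoeff hW (wsum_interleave_ne_top m f.2 j)

theorem enorm_toHardySum_sq (f : domain fun n => W.sqWeight (n / m)) :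
    ‖toHardySum hW m f‖ₑ ^ 2 = wsum (fun n => W.sqWeight (n / m)) f.1 := by
  rw [enorm_sq_eq_ofReal, PiLp.norm_sq_eq_of_L2,
    ENNReal.ofReal_sum_of_nonneg fun j _ => sq_nonneg _, wsum_interleave]
  refine Finset.sum_congr rfl fun j _ => ?_
  rw [← enorm_sq_eq_ofReal, ← Hardy.wsum_coeff, coeff_toHardySum]

theorem unitVec_mem_domain (u : ℕ → ℝ≥0) (k : ℕ) : unitVec k ∈ domain u := by
  change wsum u (unitVec k) ≠ ⊤
  rw [wsum, tsum_eq_single k fun l hl => by rw [unitVec, lp.single_apply_ne _ _ _ hl]; simp]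
  exact ENNReal.mul_ne_top ENNReal.coe_ne_top (ENNReal.pow_ne_top enorm_ne_top)

theorem denseRange_toHardy : DenseRange (toHardy hW) := by
  intro f
  rw [← LinearMap.coe_range, ← Submodule.topologicalClosure_coe]
  refine Hardy.mem_of_isClosed hW (Submodule.isClosed_topologicalClosure _) (fun k g hg => ?_) f
  refine Submodule.le_topologicalClosure _
    ⟨Hardy.coeff g k • ⟨unitVec k, unitVec_mem_domain _ k⟩, Hardy.ext_coeff fun l => ?_⟩
  rw [map_smul, Hardy.coeff_smul, Pi.smul_apply, coeff_toHardy]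
  by_cases hl : l = k
  · subst hl; simp
  · rw [hg l hl, lp.single_apply_ne _ _ _ hl, smul_zero]

theorem denseRange_toHardySum : DenseRange (toHardySum hW m) := by
  intro f
  rw [← LinearMap.coe_range, ← Submodule.topologicalClosure_coe]
  set R := (LinearMap.range (toHardySum hW m)).topologicalClosure with hR
  let ι : Fin m → Hardy W →L[ℂ] PiLp 2 (fun _ : Fin m => Hardy W) := fun j =>
    ((PiLp.continuousLinearEquiv 2 ℂ (fun _ : Fin m => Hardy W)).symm :
      (Fin m → Hardy W) →L[ℂ] PiLp 2 (fun _ : Fin m => Hardy W)) ∘L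
      ContinuousLinearMap.single ℂ (fun _ : Fin m => Hardy W) j
  have hι : ∀ j g i, ι j g i = if i = j then g else 0 := fun j g i => by
    change (Pi.single j g : Fin m → Hardy W) i = _
    rw [Pi.single_apply]
  have hsum : f = ∑ j, ι j (f j) := by
    ext1 i
    rw [WithLp.ofLp_sum, Finset.sum_apply]
    simp [hι]
  rw [hsum]
  refine R.sum_mem fun j _ => ?_
  refine Hardy.mem_of_isClosed hW (R := R.comap (ι j : Hardy W →ₗ[ℂ] _)) ?_ (fun k g hg => ?_) (f j)
  · exact (Submodule.isClosed_topologicalClosure _).preimage (ι j).continuous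
  · refine Submodule.le_topologicalClosure _
      ⟨Hardy.coeff g k • ⟨unitVec (k * m + j), unitVec_mem_domain _ _⟩, ?_⟩
    ext1 i
    refine Hardy.ext_coeff fun l => ?_
    rw [map_smul, PiLp.smul_apply, Hardy.coeff_smul, Pi.smul_apply, coeff_toHardySum]
    change _ = Hardy.coeff (ι j g i) l
    rw [hι]
    have inj : l * m + i = k * m + j ↔ l = k ∧ i = j := by
      refine ⟨fun h => ?_, fun ⟨h1, h2⟩ => by rw [h1, h2]⟩
      have := (Nat.divModEquiv m).symm.injective (a₁ := (l, i)) (a₂ := (k, j)) h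
      simpa using this
    have e : unitVec (k * m + j) (l * m + i) = if l = k ∧ i = j then (1 : ℂ) else 0 := by
      split_ifs with h
      · rw [inj.2 h]; simp
      · exact lp.single_apply_ne _ _ _ fun h' => h (inj.1 h')
    have h0 : Hardy.coeff (0 : Hardy W) l = 0 := by
      have := Hardy.coeff_smul (0 : ℂ) g
      rw [zero_smul, zero_smul] at this
      rw [this]; rfl
    change Hardy.coeff g k • unitVec (k * m + j) (l * m + i) = _
    rw [e]
    by_cases hi : i = j
    · by_cases hl : l = k
      · simp [hi, hl]
      · simp [hi, hl, hg l hl]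
    · simp [hi, h0]

end Embeddings

/-! ### Similarity -/

theorem wBounded_sqWeight {W : WeightSeq} (hW : W.PolynomialGrowth) {Φ : H2 ≃ₗᵢ[ℂ] H2}
    {ν₁ ν₂ : ℕ → ℕ}
    (h : ∀ s : ℤ, WBounded Φ.toLinearEquiv (fun n => powWeight (2 * s) (ν₁ n))
      fun n => powWeight (2 * s) (ν₂ n)) :
    WBounded Φ.toLinearEquiv (fun n => W.sqWeight (ν₁ n)) fun n => W.sqWeight (ν₂ n) := by
  obtain ⟨L, hL⟩ := hW.exists_polyRegular
  have hp := h (L + 1)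
  have hm := h (-(L + 1))
  rw [mul_neg] at hm
  exact WBounded.interpolate (s := 2 * (L + 1)) (by exact_mod_cast hp) (by exact_mod_cast hm) hL
    (by omega)

/-- The shift by `m`. -/
def shiftPow (m : ℕ) : ratAlg := shiftMul ^ m

theorem mulH_shiftPow_apply (m : ℕ) (f : H2) (n : ℕ) :
    mulH (shiftPow m) f n = if n < m then 0 else f (n - m) := by
  rw [← coeff_series, series_mulH]
  change coeff n ((X : ℂ⟦X⟧) ^ m * _) = _
  rw [PowerSeries.coeff_X_pow_mul']
  by_cases h : m ≤ n
  · rw [if_pos h, if_neg (not_lt.2 h), coeff_series]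
  · rw [if_neg h, if_pos (not_le.1 h)]

theorem mulH_shiftPow_mem_domain {m : ℕ} (hm : 0 < m) {γ : ℕ → ℝ≥0} (hγ : Admissible γ) {f : H2}
    (hf : f ∈ domain fun n => γ (n / m)) : mulH (shiftPow m) f ∈ domain fun n => γ (n / m) := by
  obtain ⟨c, N, hc⟩ := hγ
  change wsum _ (mulH (shiftPow m) f) ≠ ⊤
  have hinj := (add_left_injective m).tsum_eq
    (f := fun n => (γ (n / m) : ℝ≥0∞) * ‖mulH (shiftPow m) f n‖ₑ ^ 2) fun n hn => by
      by_cases h : m ≤ n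
      · exact ⟨n - m, Nat.sub_add_cancel h⟩
      · simp [mulH_shiftPow_apply, not_le.1 h] at hn
  rw [wsum, ← hinj]
  refine ne_top_of_le_ne_top (ENNReal.mul_ne_top (ENNReal.coe_ne_top (r := c * (1 + 1) ^ N)) hf) ?_
  rw [wsum, ← ENNReal.tsum_mul_left]
  refine ENNReal.tsum_le_tsum fun n => ?_
  rw [mulH_shiftPow_apply, if_neg (by omega), Nat.add_sub_cancel, Nat.add_div_right _ hm,
    ← mul_assoc]
  gcongr
  have := hc (n / m) 1
  push_cast at this
  exact_mod_cast this

/-- Multiplication by a finite Blaschke product is similar to a direct sum of shifts. -/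
theorem areSimilar_of_blaschke {W : WeightSeq} (hW : W.PolynomialGrowth) {m : ℕ} (hm : 0 < m)
    {c : ℕ → ℂ} (hc : ∀ i, ‖c i‖ = 1) (d : ℕ → Complex.UnitDisc) {Mz MB : Hardy W →L[ℂ] Hardy W}
    (hz : ∀ f, Hardy.toSeries (Mz f) = X * Hardy.toSeries f)
    (hB : ∀ f, Hardy.toSeries (MB f) = partialProd c d m * Hardy.toSeries f) :
    AreSimilar MB (directSumOp m Mz) := by
  have : NeZero m := ⟨hm.ne'⟩
  have := Hardy.completeSpace hW
  obtain ⟨Φ, h1, h2, h3⟩ := exists_unitary hm hc d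
  have b1 : WBounded Φ.toLinearEquiv (fun n => W.sqWeight (n / m)) W.sqWeight :=
    wBounded_sqWeight hW (ν₂ := id) h1
  have b2 : WBounded Φ.symm.toLinearEquiv W.sqWeight fun n => W.sqWeight (n / m) :=
    wBounded_sqWeight hW (ν₁ := id) h2
  have n1 : ∃ K : ℝ, ∀ f, ‖toHardy hW (domainEquiv b1 b2 f)‖ ≤ K * ‖toHardySum hW m f‖ := by
    obtain ⟨K, hK⟩ := b1
    refine ⟨_, fun f => norm_le_of_enorm_sq_le (K := K) ?_⟩
    rw [enorm_toHardy_sq, enorm_toHardySum_sq]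
    exact hK f.1
  have n2 : ∃ K : ℝ, ∀ f, ‖toHardySum hW m ((domainEquiv b1 b2).symm f)‖ ≤ K * ‖toHardy hW f‖ := by
    obtain ⟨K, hK⟩ := b2
    refine ⟨_, fun f => norm_le_of_enorm_sq_le (K := K) ?_⟩
    rw [enorm_toHardy_sq, enorm_toHardySum_sq]
    exact hK f.1
  -- `H²_β` need not be contained in `ℓ²`. The unitary is therefore restricted to the vectors of
  -- `ℓ²` with finite weighted sum, which are dense on both sides, and extended by continuity.
  set Y := (domainEquiv b1 b2).extend (toHardySum hW m) (toHardy hW)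
    (denseRange_toHardySum hW m) n1 (denseRange_toHardy hW) n2 with hY
  have hΦ : ∀ f, Φ (mulH (shiftPow m) f) = mulH (partialProd c d m) (Φ f) := by
    have : (Φ.toContinuousLinearEquiv : H2 →L[ℂ] H2) ∘L mulH (shiftPow m) =
        mulH (partialProd c d m) ∘L (Φ.toContinuousLinearEquiv : H2 →L[ℂ] H2) := by
      refine H2.clm_ext fun k => ?_
      have e : mulH (shiftPow m) (unitVec k) = unitVec (k + m) := series_injective <| by
        rw [series_mulH, series_unitVec, series_unitVec, pow_add, mul_comm]
        rfl
      change Φ (mulH (shiftPow m) (unitVec k)) = _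
      rw [e]
      exact h3 k
    exact fun f => DFunLike.congr_fun this f
  have key : ∀ y, Y (directSumOp m Mz y) = MB (Y y) := by
    refine (denseRange_toHardySum hW m).induction ?_ ?_
    · rintro _ ⟨f, rfl⟩
      obtain ⟨L, hL⟩ := hW.exists_polyRegular
      set f' : domain fun n => W.sqWeight (n / m) :=
        ⟨mulH (shiftPow m) f.1, mulH_shiftPow_mem_domain hm hL.admissible f.2⟩ with hf'
      -- Moving the index `km + j` by `m` raises `k` by one and keeps `j`, so the shift by `m` acts
      -- as `M_z` in every summand.
      have e1 : directSumOp m Mz (toHardySum hW m f) = toHardySum hW m f' := by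
        ext1 j
        refine Hardy.ext_coeff fun k => ?_
        rw [directSumOp_apply, coeff_toHardySum, ← Hardy.coeff_toSeries, hz]
        change _ = mulH (shiftPow m) f.1 (k * m + j)
        rw [mulH_shiftPow_apply]
        cases k with
        | zero => simp
        | succ k =>
          rw [PowerSeries.coeff_succ_X_mul, Hardy.coeff_toSeries, coeff_toHardySum,
            add_mul, one_mul,
            if_neg (by omega)]
          refine congrArg f.1 ?_
          omega
      rw [e1, hY, LinearEquiv.extend_eq, LinearEquiv.extend_eq]
      refine Hardy.ext_coeff fun k => ?_
      rw [coeff_toHardy, ← Hardy.coeff_toSeries, hB]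
      change Φ (mulH (shiftPow m) f.1) k = _
      rw [hΦ, ← coeff_series, series_mulH]
      congr 2
      ext l
      rw [coeff_series, Hardy.coeff_toSeries, coeff_toHardy]
      rfl
    · exact isClosed_eq (by fun_prop) (by fun_prop)
  refine ⟨Y.symm, fun x => ?_⟩
  rw [ContinuousLinearEquiv.symm_apply_eq, key, ContinuousLinearEquiv.apply_symm_apply]

end WeightedHardy

end

/-! ### The main theorem -/

theorem theorem3p6 (W : WeightedHardy.WeightSeq) (hW : W.PolynomialGrowth)
    (m : ℕ) (hm : 1 ≤ m) (θ : ℝ) (a : Fin m → Complex.UnitDisc) :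
    ∃ Mz MB : WeightedHardy.Hardy W →L[ℂ] WeightedHardy.Hardy W,
      WeightedHardy.IsMulOp (fun z => (z : ℂ)) Mz ∧
      WeightedHardy.IsMulOp (WeightedHardy.blaschke θ a) MB ∧
      WeightedHardy.AreSimilar MB (WeightedHardy.directSumOp m Mz) := by
  -- The rotation `e^{iθ}` is absorbed into the factor of index `0`, which is present because `m ≥
  -- 1`. The values of `d` beyond `m` never enter the product.
  set c : ℕ → ℂ := fun i => if i = 0 then Complex.exp (θ * Complex.I) else 1 with hc
  set d : ℕ → Complex.UnitDisc := fun i => if h : i < m then a ⟨i, h⟩ else 0 with hd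
  have hc1 : ∀ i, ‖c i‖ = 1 := fun i => by
    simp only [hc]
    split_ifs
    · exact Complex.norm_exp_ofReal_mul_I θ
    · simp
  have hT := WeightedHardy.hasTaylor_partialProd c d m
  have e : (fun z : Complex.UnitDisc => ∏ i ∈ Finset.range m,
      (c i * (((d i : ℂ) - z) / (1 - conj (d i : ℂ) * z)))) = WeightedHardy.blaschke θ a := by
    funext z
    rw [Finset.prod_mul_distrib, WeightedHardy.blaschke]
    congr 1
    · simp only [hc]
      rw [Finset.prod_ite_eq' (Finset.range m) 0, if_pos (Finset.mem_range.2 hm)]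
    · rw [Finset.prod_range]
      refine Finset.prod_congr rfl fun j _ => ?_
      simp [hd]
  rw [e] at hT
  obtain ⟨Mz, hMz⟩ := WeightedHardy.Hardy.exists_mulOp hW WeightedHardy.shiftMul
  obtain ⟨MB, hMB⟩ := WeightedHardy.Hardy.exists_mulOp hW (WeightedHardy.partialProd c d m)
  exact ⟨Mz, MB, WeightedHardy.isMulOp_of_toSeries WeightedHardy.hasTaylor_X hMz,
    WeightedHardy.isMulOp_of_toSeries hT hMB,
    WeightedHardy.areSimilar_of_blaschke hW hm hc1 d hMz hMB⟩
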